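/- Let $H_{16}\subset\mathbb F_2^{16}$ be an extended Hamming code of length $16$, i.e. a code having a parity-check matrix whose columns are the $16$ vectors $(1,v)$, $v\in\mathbb F_2^4$, in some order. A Nordstrom–Robinson code is any binary code of length $16$ with $256$ codewords and minimum distance $6$. Two partitions of $H_{16}$ into Nordstrom–Robinson codes are called isomorphic if some coordinate permutation $\pi$ with $\pi(H_{16})=H_{16}$ maps the members of the first onto the members of the second. For a code $N$ put $\mathrm{Ker}(N)=\{x\in\mathbb F_2^{16}: x+N=N\}$. A Fano plane on $\{1,\dots,7\}$ is a set of $3$-element subsets (lines) such that any two different points lie on exactly one line; the alternating group $A_7$ acts on these planes by permuting the points. 1. There are exactly two partitions of $H_{16}$ into Nordstrom–Robinson codes up to isomorphism. 2. The Fano planes on $\{1,\dots,7\}$ form exactly two $A_7$-orbits, each consisting of $15$ planes. 3. The isomorphism classes in 1 correspond to the orbits in 2. Precisely, let $N\subset H_{16}$ be a Nordstrom–Robinson code with $0\in N$. Then $N$ is a disjoint union $N=\mathrm{Ker}(N)\cup\bigcup_{i=1}^{7}(a_i+\mathrm{Ker}(N))$ for some words $a_1,\dots,a_7$, and for every such choice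 of $a_1,\dots,a_7$: (a) the map sending a Fano plane $S$ to the family $$\mathcal P_S=\{N\}\cup\{a_i+a_j+a_k+N:\ \{i,j,k\}\in S\}$$ is a bijection from the Fano planes on $\{1,\dots,7\}$ onto the partitions of $H_{16}$ into Nordstrom–Robinson codes that have $N$ as a member; (b) $\mathcal P_S$ and $\mathcal P_T$ are isomorphic if and only if $S$ and $T$ lie in the same $A_7$-orbit; (c) every partition of $H_{16}$ into Nordstrom–Robinson codes is isomorphic to $\mathcal P_S$ for some Fano plane $S$. -/

import Mathlib

open scoped Pointwise

/-- The binary space `F_2^16` (with the Hamming distance `hammingDist`). -/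
abbrev Word : Type := Fin 16 → ZMod 2

/-- The translate `v + C` of a code. -/
def codeTranslate (v : Word) (C : Set Word) : Set Word := (fun x => v + x) '' C

/-- The action of a coordinate permutation on words: `π(y) = (y_{π(1)}, …, y_{π(16)})`. -/
def permWord (π : Equiv.Perm (Fin 16)) (y : Word) : Word := fun i => y (π i)

/-- The image `π(C)` of a code under a coordinate permutation. -/
def permCode (π : Equiv.Perm (Fin 16)) (C : Set Word) : Set Word := permWord π '' C

/-- `Sym(C)`: the coordinate permutations that map the code `C` onto itself. -/
def codeSym (C : Set Word) : Set (Equiv.Perm (Fin 16)) := {π | permCode π C = C}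

/-- Extended Hamming codes of length 16: the columns of a parity-check matrix are the
16 vectors `(1, v)`, `v ∈ F_2^4`, in some order `e`. -/
def IsExtendedHamming (H : Set Word) : Prop :=
  ∃ e : Fin 16 ≃ (Fin 4 → ZMod 2),
    H = {x : Word | ∑ i, x i = 0 ∧ ∑ i, x i • e i = 0}

/-- Nordstrom–Robinson codes: all binary codes of length 16 with 256 words and minimum
distance 6. -/
def IsNordstromRobinson (C : Set Word) : Prop :=
  C.ncard = 256 ∧ IsLeast {d : ℕ | ∃ x ∈ C, ∃ y ∈ C, x ≠ y ∧ hammingDist x y = d} 6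

/-- The kernel of a code: the words `x` with `x + C = C`. -/
def codeKer (C : Set Word) : Set Word := {x | codeTranslate x C = C}

/-- `P` is a partition of `H` into Nordstrom–Robinson codes. -/
def IsNRPartition (H : Set Word) (P : Set (Set Word)) : Prop :=
  (∀ C ∈ P, IsNordstromRobinson C) ∧ P.PairwiseDisjoint id ∧ ⋃₀ P = H

/-- Two partitions of `H` are isomorphic if some `π ∈ Sym(H)` maps the members of the first
one onto the members of the second one. -/
def PartitionIso (H : Set Word) (P Q : Set (Set Word)) : Prop :=
  ∃ π ∈ codeSym H, permCode π '' P = Q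

/-- A Fano plane on the points `Fin 7`, given by its set of lines: every line has three
points and every two different points lie on exactly one line. -/
def IsFanoPlane (S : Finset (Finset (Fin 7))) : Prop :=
  (∀ L ∈ S, L.card = 3) ∧ ∀ i j : Fin 7, i ≠ j → ∃! L, L ∈ S ∧ i ∈ L ∧ j ∈ L

/-- The orbit of a set of lines under the alternating group `A_7` on the points. -/
def a7Orbit (S : Finset (Finset (Fin 7))) : Set (Finset (Finset (Fin 7))) :=
  MulAction.orbit (alternatingGroup (Fin 7)) S

/-- `N` is the disjoint union of `Ker(N)` and the seven cosets `a i + Ker(N)`. -/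
def IsKerDecomposition (N : Set Word) (a : Fin 7 → Word) : Prop :=
  N = codeKer N ∪ ⋃ i, codeTranslate (a i) (codeKer N) ∧
    (∀ i, Disjoint (codeKer N) (codeTranslate (a i) (codeKer N))) ∧
    ∀ i j, i ≠ j → Disjoint (codeTranslate (a i) (codeKer N)) (codeTranslate (a j) (codeKer N))

/-- The family consisting of `N` and of the codes `a_i + a_j + a_k + N`, where `{i, j, k}`
runs over the lines of `S`. -/
def planePartition (N : Set Word) (a : Fin 7 → Word) (S : Finset (Finset (Fin 7))) :
    Set (Set Word) :=
  {N} ∪ {C | ∃ L ∈ S, C = codeTranslate (∑ i ∈ L, a i) N}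

/-! Modulo the 32 affine functions on F_2^4, the extended Hamming code becomes the 64-element space
of bivectors: `theta` sums the quadratic monomials over a word, and its kernel on the code is the
set of affine words. The Pfaffian `pf` is the Klein quadratic form on this space, and words of
weight four have singular bivectors.

A Nordstrom–Robinson code N inside the Hamming code is invariant under affine words
(`add_affineWord_mem`). Distance six forces a double covering of the Hamming code by N and certain
words of weight four; on the Fourier side, every character in the spectrum of N that is nontrivial
on the Hamming code is a bent function, and these are orthogonal to affine words. So N is the
preimage of eight bivectors, and distance six makes their pairwise sums nonsingular
(`IsNordstromRobinson.exists_clique`). All such cliques are translates of one another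
(`IsClique.range_eq_translate`), so the Nordstrom–Robinson codes in the Hamming code are the cells
`cell e k x`, and distinct cells are disjoint exactly when the sum of their indices is singular.

If the clique contains zero, the sums of at most three of its other seven members give each bivector
once, and the nonzero singular ones are the 35 sums of triples. A partition containing N thus
becomes a set of triples; covering and disjointness say that any two points lie on a unique triple,
which is a Fano plane (`Biv.IsClique.bijOn`).

The index set of a partition is the annihilator of a nonzero vector, under x or under its
complementary matrix: two families of 15 totally singular subspaces. A transposition of points acts
as a reflection and exchanges the families, so the families are the A_7-orbits
(`IsClique.mem_a7Orbit_iff`). Planes of one type are related by shears, which are coordinate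
permutations preserving the Hamming code (`Biv.IsClique.iso_of_hasType`); the types are separated by
the invariant `HasPair`. -/

/-- Vectors of the four-dimensional binary space. -/
abbrev Vec : Type := Fin 4 → ZMod 2

/-- Bivectors over `Vec`, in the coordinates `01, 02, 03, 12, 13, 23`. -/
abbrev Biv : Type := Fin 6 → ZMod 2

/-! ### Bivector algebra: Pfaffian, alternating matrices, shears -/

namespace Biv

/-- The Pfaffian (the Klein quadratic form). -/
def pf (x : Biv) : ZMod 2 := x 0 * x 5 + x 1 * x 4 + x 2 * x 3

/-- The polar form of the Pfaffian. -/
def polar (x y : Biv) : ZMod 2 :=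
  x 0 * y 5 + x 5 * y 0 + x 1 * y 4 + x 4 * y 1 + x 2 * y 3 + x 3 * y 2

/-- The product of the alternating matrix `x` and the vector `v`. -/
def act (x : Biv) (v : Vec) : Vec :=
  ![x 0 * v 1 + x 1 * v 2 + x 2 * v 3, x 0 * v 0 + x 3 * v 2 + x 4 * v 3,
    x 1 * v 0 + x 3 * v 1 + x 5 * v 3, x 2 * v 0 + x 4 * v 1 + x 5 * v 2]

/-- The complementary alternating matrix. -/
def star (x : Biv) : Biv := ![x 5, x 4, x 3, x 2, x 1, x 0]

/-- The exterior product of two vectors. -/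
def wedge (u v : Vec) : Biv :=
  ![u 0 * v 1 + u 1 * v 0, u 0 * v 2 + u 2 * v 0, u 0 * v 3 + u 3 * v 0,
    u 1 * v 2 + u 2 * v 1, u 1 * v 3 + u 3 * v 1, u 2 * v 3 + u 3 * v 2]

/-- The standard scalar product on `Vec`. -/
def dot (u v : Vec) : ZMod 2 := u 0 * v 0 + u 1 * v 1 + u 2 * v 2 + u 3 * v 3

/-- The action on bivectors of the linear map `v ↦ v + (l · v) u`. -/
def shear (l u : Vec) (x : Biv) : Biv := x + wedge u (act x l)

theorem add_self (x : Biv) : x + x = 0 := by ext i; exact CharTwo.add_self_eq_zero _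

theorem pf_add (x y : Biv) : pf (x + y) = pf x + pf y + polar x y := by
  simp only [pf, polar, Pi.add_apply]; ring

/-- Each single Pfaffian occurs in three pairs, hence once modulo two, and each polar term occurs
once. This makes four members of a clique add up to a singular bivector. -/
theorem pf_add_four (a b c d : Biv) : pf (a + b + c + d) =
    pf (a + b) + pf (a + c) + pf (a + d) + pf (b + c) + pf (b + d) + pf (c + d) := by
  simp only [pf, Pi.add_apply]; grind

theorem polar_add_left (x y z : Biv) : polar (x + y) z = polar x z + polar y z := by
  simp only [polar, Pi.add_apply]; ring

theorem polar_add_right (x y z : Biv) : polar x (y + z) = polar x y + polar x z := by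
  simp only [polar, Pi.add_apply]; ring

theorem act_add (x y : Biv) (v : Vec) : act (x + y) v = act x v + act y v := by
  ext i; fin_cases i <;> simp [act] <;> ring

theorem star_star (x : Biv) : star (star x) = x := by
  ext i; fin_cases i <;> simp [star]

theorem star_add (x y : Biv) : star (x + y) = star x + star y := by
  ext i; fin_cases i <;> simp [star]

theorem pf_star (x : Biv) : pf (star x) = pf x := by simp [pf, star]; ring

theorem polar_star (x y : Biv) : polar (star x) (star y) = polar x y := by
  simp [polar, star]; ring

/-- The complementary matrix plays the role of an adjugate, with the Pfaffian in place of the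
determinant. Polarising in x gives `act_star_act_comm`. -/
theorem act_star_act (x : Biv) (v : Vec) : act (star x) (act x v) = pf x • v := by
  ext i; fin_cases i <;> simp [act, star, pf] <;> grind

theorem act_star_act_comm (x c : Biv) (v : Vec) :
    act (star x) (act c v) = polar x c • v + act (star c) (act x v) := by
  ext i; fin_cases i <;> simp [act, star, polar] <;> grind

theorem dot_act_self (x : Biv) (v : Vec) : dot v (act x v) = 0 := by
  simp [dot, act]; grind

theorem pf_wedge (u v : Vec) : pf (wedge u v) = 0 := by
  simp [pf, wedge]; grind

theorem act_star_wedge (u v : Vec) : act (star (wedge u v)) u = 0 := by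
  ext i; fin_cases i <;> simp [act, star, wedge] <;> grind

theorem shear_add (l u : Vec) (x y : Biv) : shear l u (x + y) = shear l u x + shear l u y := by
  ext i; fin_cases i <;> simp [-Matrix.add_cons, -Matrix.cons_add, shear, act, wedge] <;> ring

theorem shear_shear (l u : Vec) (h : dot l u = 0) (x : Biv) :
    shear l u (shear l u x) = x := by
  ext i; fin_cases i <;> simp [-Matrix.add_cons, -Matrix.cons_add, shear, act, wedge, dot] at * <;> grind

theorem shear_wedge (l u v w : Vec) :
    shear l u (wedge v w) = wedge (v + dot l v • u) (w + dot l w • u) := by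
  ext i; fin_cases i <;> simp [-Matrix.add_cons, -Matrix.cons_add, shear, act, wedge, dot] <;> grind

theorem pf_shear (l u : Vec) (h : dot l u = 0) (x : Biv) : pf (shear l u x) = pf x := by
  simp [-Matrix.add_cons, -Matrix.cons_add, shear, pf, act, wedge, dot] at *; grind

/-- With A the matrix of the linear map, the sheared alternating matrix is A x Aᵀ. Its kernel
therefore moves by the inverse transpose of A, in which l and u trade places. -/
theorem act_shear (l u h : Vec) (hl : dot l u = 0) (x : Biv) (hx : act x h = 0) :
    act (shear l u x) (h + dot h u • l) = 0 := by
  have h0 := congrFun hx 0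
  have h1 := congrFun hx 1
  have h2 := congrFun hx 2
  have h3 := congrFun hx 3
  simp [-Matrix.add_cons, -Matrix.cons_add, act] at h0 h1 h2 h3
  ext i; fin_cases i <;> simp [-Matrix.add_cons, -Matrix.cons_add, shear, act, wedge, dot] at * <;> grind
end Biv

/-! ### Cliques of eight bivectors -/

namespace Biv

/-- Eight bivectors with pairwise nonsingular sums. -/
def IsClique (k : Fin 8 → Biv) : Prop := ∀ i j, i ≠ j → pf (k i + k j) = 1

/-- The sum of the members `k (i + 1)` with `i` in a set of points. -/
def lineSum (k : Fin 8 → Biv) (L : Finset (Fin 7)) : Biv := ∑ i ∈ L, k i.succ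

theorem add_eq_zero_iff {x y : Biv} : x + y = 0 ↔ x = y := by
  constructor
  · intro h
    have : x + y + y = y := by rw [h, zero_add]
    rwa [add_assoc, add_self, add_zero] at this
  · rintro rfl; exact add_self x

theorem add_add_cancel (x y : Biv) : x + y + y = x := by rw [add_assoc, add_self, add_zero]

theorem pf_zero : pf 0 = 0 := by simp [pf]

theorem polar_self (x : Biv) : polar x x = 0 := by simp [polar]; grind

theorem polar_zero_right (x : Biv) : polar x 0 = 0 := by simp [polar]

theorem polar_zero_left (x : Biv) : polar 0 x = 0 := by simp [polar]

theorem act_zero (v : Vec) : act 0 v = 0 := by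
  ext i; fin_cases i <;> simp [act]

theorem act_zero_right (x : Biv) : act x 0 = 0 := by
  ext i; fin_cases i <;> simp [act]

theorem star_zero : star 0 = 0 := by
  ext i; fin_cases i <;> simp [star]

theorem pf_add_four_of_eq_one {a b c d : Biv} (h₁ : pf (a + b) = 1) (h₂ : pf (a + c) = 1)
    (h₃ : pf (a + d) = 1) (h₄ : pf (b + c) = 1) (h₅ : pf (b + d) = 1) (h₆ : pf (c + d) = 1) :
    pf (a + b + c + d) = 0 := by
  rw [pf_add_four, h₁, h₂, h₃, h₄, h₅, h₆]; decide

variable {k : Fin 8 → Biv}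

theorem IsClique.injective (hk : IsClique k) : Function.Injective k := by
  intro i j h
  by_contra hne
  have := hk i j hne
  rw [h, add_self, pf_zero] at this
  exact zero_ne_one this

theorem IsClique.translate (hk : IsClique k) (x : Biv) : IsClique (fun i => k i + x) := by
  intro i j h
  have : k i + x + (k j + x) = k i + k j := by
    rw [add_comm (k j), ← add_assoc, add_add_cancel]
  simp only [this]; exact hk i j h

theorem IsClique.pf_succ (hk : IsClique k) (h0 : k 0 = 0) (i : Fin 7) : pf (k i.succ) = 1 := by
  have := hk i.succ 0 (Fin.succ_ne_zero i)
  rwa [h0, add_zero] at this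

theorem IsClique.polar_succ (hk : IsClique k) (h0 : k 0 = 0) {i j : Fin 7} (h : i ≠ j) :
    polar (k i.succ) (k j.succ) = 1 := by
  have := hk i.succ j.succ (by simpa using h)
  rw [pf_add, hk.pf_succ h0, hk.pf_succ h0] at this
  have h2 : (1 + 1 : ZMod 2) = 0 := by decide
  rwa [h2, zero_add] at this

theorem IsClique.polar_lineSum (hk : IsClique k) (h0 : k 0 = 0) (i : Fin 7)
    (L : Finset (Fin 7)) :
    polar (k i.succ) (lineSum k L) = (L.card : ZMod 2) + if i ∈ L then 1 else 0 := by
  induction L using Finset.induction_on with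
  | empty => simp [lineSum, polar_zero_right]
  | insert j L hj ih =>
    rw [lineSum, Finset.sum_insert hj, polar_add_right]
    change _ + polar _ (lineSum k L) = _
    rw [ih, Finset.card_insert_of_notMem hj]
    by_cases hij : i = j
    · subst hij
      simp [polar_self, hj]; grind
    · rw [hk.polar_succ h0 hij]
      simp [hij]; ring

theorem IsClique.pf_lineSum (hk : IsClique k) (h0 : k 0 = 0) (L : Finset (Fin 7)) :
    pf (lineSum k L) = ((L.card + 1).choose 2 : ℕ) := by
  induction L using Finset.induction_on with
  | empty => simp [lineSum, pf_zero]
  | insert j L hj ih =>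
    rw [lineSum, Finset.sum_insert hj, pf_add]
    change _ + pf (lineSum k L) + polar _ (lineSum k L) = _
    rw [ih, Finset.card_insert_of_notMem hj, hk.polar_lineSum h0, hk.pf_succ h0, if_neg hj,
      Nat.choose_succ_succ (L.card + 1) 1]
    simp; ring

theorem lineSum_symmDiff (L M : Finset (Fin 7)) :
    lineSum k L + lineSum k M = lineSum k (symmDiff L M) := by
  unfold lineSum
  rw [← Finset.sum_sdiff (Finset.inter_subset_left : L ∩ M ⊆ L),
    ← Finset.sum_sdiff (Finset.inter_subset_right : L ∩ M ⊆ M), symmDiff_def, Finset.sup_eq_union,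
    Finset.sum_union disjoint_sdiff_sdiff, Finset.sdiff_inter_self_left,
    Finset.sdiff_inter_self_right]
  have := add_self (∑ i ∈ L ∩ M, k i.succ)
  linear_combination this

/-- Pairing the sum with a member inside L and with one outside L gives two values that differ by
one, so they cannot both vanish. -/
theorem IsClique.eq_empty_or_univ (hk : IsClique k) (h0 : k 0 = 0) {L : Finset (Fin 7)}
    (h : lineSum k L = 0) : L = ∅ ∨ L = Finset.univ := by
  have key : ∀ i, ((L.card : ZMod 2) + if i ∈ L then 1 else 0) = 0 := fun i => by
    rw [← hk.polar_lineSum h0, h, polar_zero_right]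
  by_contra! hL
  obtain ⟨⟨i, hi⟩, hL2⟩ := hL
  obtain ⟨j, hj⟩ : ∃ j, j ∉ L := by
    by_contra! hc
    exact hL2 (Finset.eq_univ_of_forall hc)
  have h1 := key i
  have h2 := key j
  rw [if_pos hi] at h1
  rw [if_neg hj, add_zero] at h2
  rw [h2, zero_add] at h1
  exact one_ne_zero h1

theorem IsClique.lineSum_inj (hk : IsClique k) (h0 : k 0 = 0) {L M : Finset (Fin 7)}
    (hL : L.card ≤ 3) (hM : M.card ≤ 3) (h : lineSum k L = lineSum k M) : L = M := by
  rw [← add_eq_zero_iff, lineSum_symmDiff] at h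
  rcases hk.eq_empty_or_univ h0 h with h | h
  · exact symmDiff_eq_bot.mp h
  · exfalso
    have h7 : (symmDiff L M).card = 7 := by rw [h]; rfl
    have : (symmDiff L M).card ≤ L.card + M.card := by
      refine (Finset.card_le_card ?_).trans (Finset.card_union_le L M)
      exact symmDiff_le_sup
    omega

/-- Counting: there are 1 + 7 + 21 + 35 = 64 sets of at most three points, their sums are distinct,
and there are 64 bivectors. -/
theorem IsClique.exists_lineSum (hk : IsClique k) (h0 : k 0 = 0) (x : Biv) :
    ∃ L : Finset (Fin 7), L.card ≤ 3 ∧ lineSum k L = x := by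
  let f : {L : Finset (Fin 7) // L.card ≤ 3} → Biv := fun L => lineSum k L
  have hinj : Function.Injective f := fun L M h =>
    Subtype.ext (hk.lineSum_inj h0 L.2 M.2 h)
  have hcard : Fintype.card {L : Finset (Fin 7) // L.card ≤ 3} = Fintype.card Biv := by
    rw [Fintype.card_subtype]
    simp only [Fintype.card_pi, ZMod.card, Finset.prod_const]
    decide +kernel
  obtain ⟨L, hL⟩ := ((Fintype.bijective_iff_injective_and_card f).mpr ⟨hinj, hcard⟩).2 x
  exact ⟨L, L.2, hL⟩

/-- By `IsClique.pf_lineSum`, sums of one or two points are nonsingular, so only the empty set and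
triples remain. -/
theorem IsClique.exists_triple (hk : IsClique k) (h0 : k 0 = 0) {x : Biv} (hx : pf x = 0)
    (hne : x ≠ 0) : ∃ L : Finset (Fin 7), L.card = 3 ∧ lineSum k L = x := by
  obtain ⟨L, hL, rfl⟩ := hk.exists_lineSum h0 x
  refine ⟨L, ?_, rfl⟩
  rw [hk.pf_lineSum h0] at hx
  interval_cases h : L.card
  · rw [Finset.card_eq_zero] at h
    subst h
    simp [lineSum] at hne
  · exact absurd hx (by decide)
  · exact absurd hx (by decide)
  · rfl

theorem IsClique.exists_pair_of_zero (hk : IsClique k) (h0 : k 0 = 0) {x : Biv}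
    (hx : pf x = 1) : ∃ i j, i ≠ j ∧ x = k i + k j := by
  obtain ⟨L, hL, rfl⟩ := hk.exists_lineSum h0 x
  rw [hk.pf_lineSum h0] at hx
  interval_cases h : L.card
  · exact absurd hx (by decide)
  · obtain ⟨a, rfl⟩ := Finset.card_eq_one.mp h
    exact ⟨a.succ, 0, Fin.succ_ne_zero a, by simp [lineSum, h0]⟩
  · obtain ⟨a, b, hab, rfl⟩ := Finset.card_eq_two.mp h
    exact ⟨a.succ, b.succ, by simpa using hab, by simp [lineSum, Finset.sum_pair hab]⟩
  · exact absurd hx (by decide)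

theorem IsClique.exists_pair (hk : IsClique k) {x : Biv} (hx : pf x = 1) :
    ∃ i j, i ≠ j ∧ x = k i + k j := by
  obtain ⟨i, j, hij, h⟩ := (hk.translate (k 0)).exists_pair_of_zero (add_self _) hx
  refine ⟨i, j, hij, ?_⟩
  rw [h, add_comm (k j), ← add_assoc, add_add_cancel]

theorem IsClique.four_ne (hk : IsClique k) {a b c d : Fin 8} (hab : a ≠ b) (hac : a ≠ c)
    (had : a ≠ d) (hbc : b ≠ c) (hbd : b ≠ d) (hcd : c ≠ d) : pf (k a + k b + k c + k d) = 0 :=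
  pf_add_four_of_eq_one (hk _ _ hab) (hk _ _ hac) (hk _ _ had) (hk _ _ hbc) (hk _ _ hbd)
    (hk _ _ hcd)

/-- Two pairs from a clique with nonsingular sum have a common member. -/
theorem IsClique.common (hk : IsClique k) {a b c d : Fin 8} (hab : a ≠ b) (hcd : c ≠ d)
    (h : pf (k a + k b + (k c + k d)) = 1) : a = c ∨ a = d ∨ b = c ∨ b = d := by
  by_contra! hc
  rw [← add_assoc, hk.four_ne hab hc.1 hc.2.1 hc.2.2.1 hc.2.2.2 hcd] at h
  exact zero_ne_one h

/-- If the sum were a fourth member `k d`, adding a fifth member `k n` would give `k d + k n`,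
nonsingular by the clique condition, yet singular as a sum of four distinct members. -/
theorem IsClique.add_three_ne (hk : IsClique k) {a b c : Fin 8} (hab : a ≠ b) (hac : a ≠ c)
    (hbc : b ≠ c) (d : Fin 8) : k a + k b + k c ≠ k d := by
  intro h
  by_cases hda : d = a
  · subst hda
    have : k b + k c = 0 := by
      have := congrArg (k d + ·) h
      simpa only [← add_assoc, add_self, zero_add] using this
    exact hbc (hk.injective (add_eq_zero_iff.mp this))
  by_cases hdb : d = b
  · subst hdb
    have : k a + k c = 0 := by
      have := congrArg (k d + ·) h
      rwa [add_self, add_comm (k a), add_assoc, ← add_assoc, add_self, zero_add] at this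
    exact hac (hk.injective (add_eq_zero_iff.mp this))
  by_cases hdc : d = c
  · subst hdc
    have : k a + k b = 0 := by
      have := congrArg (· + k d) h
      simpa only [add_add_cancel, add_self] using this
    exact hab (hk.injective (add_eq_zero_iff.mp this))
  obtain ⟨n, hn1, hn2, hn3, hn4⟩ : ∃ n, n ≠ a ∧ n ≠ b ∧ n ≠ c ∧ n ≠ d := by
    have : ({a, b, c, d} : Finset (Fin 8)) ≠ Finset.univ := by
      intro hu
      have h1 := Finset.card_le_four (a := a) (b := b) (c := c) (d := d)
      rw [hu] at h1
      simp at h1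
    obtain ⟨n, hn⟩ : ∃ n, n ∉ ({a, b, c, d} : Finset (Fin 8)) := by
      by_contra! hc
      exact this (Finset.eq_univ_of_forall hc)
    simp at hn
    exact ⟨n, hn.1, hn.2.1, hn.2.2.1, hn.2.2.2⟩
  have h1 := hk.four_ne hab hac hn1.symm hbc hn2.symm hn3.symm
  rw [h, hk _ _ (Ne.symm hn4)] at h1
  exact one_ne_zero h1

/-- The sums `k' 0 + k' n` are sums of pairs from `k`, and these pairs meet one another. Pairwise
meeting pairs either share a point i or form a triangle; a shared i makes `k i + k' 0` the required
translation. -/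
theorem IsClique.range_subset_translate {k' : Fin 8 → Biv} (hk : IsClique k)
    (hk' : IsClique k') : ∃ m, ∀ n, ∃ i, k' n = k i + m := by
  obtain ⟨a, b, hab, h1⟩ := hk.exists_pair (hk' 0 1 (by decide))
  obtain ⟨c, d, hcd, h2⟩ := hk.exists_pair (hk' 0 2 (by decide))
  have key : ∀ i j l : Fin 8, i ≠ j → i ≠ l → k' 0 + k' 1 = k i + k j →
      k' 0 + k' 2 = k i + k l → ∃ m, ∀ n, ∃ i, k' n = k i + m := by
    intro i j l hij hil h1 h2
    have hpair : ∀ n, n ≠ 0 → n ≠ 1 → n ≠ 2 → ∃ p, k' 0 + k' n = k i + k p := by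
      intro n hn0 hn1 hn2
      obtain ⟨p, q, hpq, h3⟩ := hk.exists_pair (hk' 0 n hn0.symm)
      have e1 : pf (k i + k j + (k p + k q)) = 1 := by
        rw [← h1, ← h3, add_comm (k' 0), add_assoc, ← add_assoc (k' 0), add_self, zero_add]
        exact hk' _ _ hn1.symm
      have e2 : pf (k i + k l + (k p + k q)) = 1 := by
        rw [← h2, ← h3, add_comm (k' 0), add_assoc, ← add_assoc (k' 0), add_self, zero_add]
        exact hk' _ _ hn2.symm
      by_cases hip : i = p
      · exact ⟨q, by rw [h3, hip]⟩
      by_cases hiq : i = q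
      · exact ⟨p, by rw [h3, hiq, add_comm]⟩
      -- The triangle case: the pair is {j, l}, so `k' n` would be the sum of `k' 0`, `k' 1` and `k'
      -- 2`.
      exfalso
      have hjl : j ≠ l := by
        rintro rfl
        have : k' 0 + k' 1 = k' 0 + k' 2 := by rw [h1, h2]
        exact absurd (hk'.injective (add_left_cancel this)) (by decide)
      have h12 : k' 1 + k' 2 = k j + k l := by
        have : k' 0 + k' 1 + (k' 0 + k' 2) = k i + k j + (k i + k l) := by rw [h1, h2]
        rwa [add_comm (k' 0), add_assoc, ← add_assoc (k' 0), add_self, zero_add,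
          add_comm (k i), add_assoc, ← add_assoc (k i), add_self, zero_add] at this
      have h4 : k' 0 + k' n = k' 1 + k' 2 := by
        rw [h3, h12]
        have := hk.common hij hpq e1
        have := hk.common hil hpq e2
        have : (j = p ∧ l = q) ∨ (j = q ∧ l = p) := by grind
        rcases this with ⟨rfl, rfl⟩ | ⟨rfl, rfl⟩
        · rfl
        · exact add_comm _ _
      refine hk'.add_three_ne (a := 0) (b := 1) (c := 2) (by decide) (by decide) (by decide) n ?_
      rw [add_assoc, ← h4, ← add_assoc, add_self, zero_add]
    refine ⟨k i + k' 0, fun n => ?_⟩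
    have hfin : ∀ p, k' 0 + k' n = k i + k p → ∃ i', k' n = k i' + (k i + k' 0) := by
      intro p hp
      refine ⟨p, ?_⟩
      rw [← add_assoc, add_comm (k p), ← hp, add_comm (k' 0), add_add_cancel]
    by_cases hn0 : n = 0
    · exact hfin i (by rw [hn0, add_self, add_self])
    by_cases hn1 : n = 1
    · exact hfin j (by rw [hn1, h1])
    by_cases hn2 : n = 2
    · exact hfin l (by rw [hn2, h2])
    · obtain ⟨p, hp⟩ := hpair n hn0 hn1 hn2
      exact hfin p hp
  have e : pf (k a + k b + (k c + k d)) = 1 := by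
    rw [← h1, ← h2, add_comm (k' 0), add_assoc, ← add_assoc (k' 0), add_self, zero_add]
    exact hk' _ _ (by decide)
  rcases hk.common hab hcd e with rfl | rfl | rfl | rfl
  · exact key a b d hab hcd h1 h2
  · exact key a b c hab hcd.symm h1 (by rw [h2, add_comm])
  · exact key b a d hab.symm hcd (by rw [h1, add_comm]) h2
  · exact key b a c hab.symm hcd.symm (by rw [h1, add_comm]) (by rw [h2, add_comm])

/-- Any two cliques of eight bivectors are translates of each other. -/
theorem IsClique.range_eq_translate {k' : Fin 8 → Biv} (hk : IsClique k)
    (hk' : IsClique k') : ∃ m, Set.range k' = Set.range fun i => k i + m := by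
  obtain ⟨m, hm⟩ := hk.range_subset_translate hk'
  refine ⟨m, ?_⟩
  apply Set.eq_of_subset_of_ncard_le
  · rintro _ ⟨n, rfl⟩
    obtain ⟨i, hi⟩ := hm n
    exact ⟨i, hi.symm⟩
  · rw [← Set.image_univ, ← Set.image_univ, Set.ncard_image_of_injective _ hk'.injective,
      Set.ncard_image_of_injective _ (hk.translate m).injective]
  · exact Set.finite_range _

/-- A clique has trivial stabiliser. -/
theorem IsClique.eq_zero_of_translate (hk : IsClique k) {m : Biv}
    (h : ∀ i, ∃ j, k i + m = k j) : m = 0 := by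
  by_contra hm
  obtain ⟨j, hj⟩ := h 0
  have hj0 : (0 : Fin 8) ≠ j := by
    rintro rfl
    exact hm (by simpa using hj)
  obtain ⟨l, hl0, hlj⟩ : ∃ l : Fin 8, l ≠ 0 ∧ l ≠ j := by
    have := (by decide : ∀ j : Fin 8, ∃ l : Fin 8, l ≠ 0 ∧ l ≠ j)
    exact this j
  obtain ⟨n, hn⟩ := h l
  refine hk.add_three_ne hj0 hl0.symm hlj.symm n ?_
  rw [← hn, ← hj, ← add_assoc, add_self, zero_add, add_comm]

end Biv

/-! ### Fano planes on seven points and their uniqueness up to relabelling -/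

theorem IsFanoPlane.eq_of_mem {S : Finset (Finset (Fin 7))} (hS : IsFanoPlane S)
    {L M : Finset (Fin 7)} (hL : L ∈ S) (hM : M ∈ S) {i j : Fin 7} (hij : i ≠ j)
    (hiL : i ∈ L) (hjL : j ∈ L) (hiM : i ∈ M) (hjM : j ∈ M) : L = M :=
  (hS.2 i j hij).unique ⟨hL, hiL, hjL⟩ ⟨hM, hiM, hjM⟩

/-- Fano planes are maximal among Fano planes. -/
theorem IsFanoPlane.eq_of_subset {S T : Finset (Finset (Fin 7))} (hS : IsFanoPlane S)
    (hT : IsFanoPlane T) (h : S ⊆ T) : S = T := by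
  refine Finset.Subset.antisymm h fun L hL => ?_
  obtain ⟨i, hi, j, hj, hij⟩ := Finset.one_lt_card.mp (by rw [hT.1 L hL]; norm_num : 1 < L.card)
  obtain ⟨M, ⟨hM, hiM, hjM⟩, -⟩ := hS.2 i j hij
  rwa [hT.eq_of_mem hL (h hM) hij hi hj hiM hjM]

theorem IsFanoPlane.smul {S : Finset (Finset (Fin 7))} (hS : IsFanoPlane S)
    (σ : Equiv.Perm (Fin 7)) : IsFanoPlane (σ • S) := by
  constructor
  · intro L hL
    rw [← Finset.inv_smul_mem_iff] at hL
    rw [← hS.1 _ hL, Finset.card_smul_finset]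
  · intro i j hij
    obtain ⟨L, ⟨hL, hi, hj⟩, hu⟩ := hS.2 (σ⁻¹ • i) (σ⁻¹ • j) (by simpa using hij)
    refine ⟨σ • L, ⟨Finset.smul_mem_smul_finset hL, ?_, ?_⟩, ?_⟩
    · rwa [← Finset.inv_smul_mem_iff]
    · rwa [← Finset.inv_smul_mem_iff]
    · rintro M ⟨hM, hiM, hjM⟩
      have := hu (σ⁻¹ • M) ⟨by rwa [Finset.inv_smul_mem_iff],
        Finset.smul_mem_smul_finset hiM, Finset.smul_mem_smul_finset hjM⟩
      rw [← this, smul_inv_smul]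

/-- A Fano plane. -/
def stdPlane : Finset (Finset (Fin 7)) :=
  {{0, 1, 2}, {0, 3, 4}, {1, 3, 5}, {2, 3, 6}, {0, 5, 6}, {1, 4, 6}, {2, 4, 5}}

theorem stdPlane_isFanoPlane : IsFanoPlane stdPlane := by
  constructor
  · decide +kernel
  · have : ∀ i j : Fin 7, i ≠ j → ∃ L ∈ stdPlane, (i ∈ L ∧ j ∈ L) ∧
        ∀ M ∈ stdPlane, i ∈ M → j ∈ M → M = L := by decide +kernel
    intro i j hij
    obtain ⟨L, hL, hh, hu⟩ := this i j hij
    exact ⟨L, ⟨hL, hh⟩, fun M hM => hu M hM.1 hM.2.1 hM.2.2⟩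

theorem IsFanoPlane.exists_third {S : Finset (Finset (Fin 7))} (hS : IsFanoPlane S)
    {i j : Fin 7} (hij : i ≠ j) : ∃ l, l ≠ i ∧ l ≠ j ∧ {i, j, l} ∈ S := by
  obtain ⟨L, ⟨hL, hi, hj⟩, -⟩ := hS.2 i j hij
  have h3 := hS.1 L hL
  have h1 : ((L.erase i).erase j).card = 1 := by
    rw [Finset.card_erase_of_mem (by simp [hj, hij.symm]), Finset.card_erase_of_mem hi, h3]
  obtain ⟨l, hl⟩ := Finset.card_eq_one.mp h1
  have hl' : l ∈ (L.erase i).erase j := by rw [hl]; simp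
  simp at hl'
  refine ⟨l, hl'.2.1, hl'.1, ?_⟩
  have : L = {i, j, l} := by
    rw [← Finset.insert_erase hi, ← Finset.insert_erase (s := L.erase i) (a := j)
      (by simp [hj, hij.symm]), hl]
  rwa [← this]

/-- Take a line {0, 1, k}, a point l off it, and the third points p, q, r of the lines joining l to
0, 1, k. These are all seven points, and the three remaining lines are forced; maximality of Fano
planes finishes. -/
theorem IsFanoPlane.exists_smul {S : Finset (Finset (Fin 7))} (hS : IsFanoPlane S) :
    ∃ σ : Equiv.Perm (Fin 7), S = σ • stdPlane := by
  have eqm := fun {L M : Finset (Fin 7)} (hL : L ∈ S) (hM : M ∈ S) {i j : Fin 7} (hij : i ≠ j) =>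
    hS.eq_of_mem hL hM hij
  have h01 : (0 : Fin 7) ≠ 1 := by decide
  obtain ⟨k, hk0, hk1, hk⟩ := hS.exists_third h01
  obtain ⟨l, hl0, hl1, hlk⟩ : ∃ l : Fin 7, l ≠ 0 ∧ l ≠ 1 ∧ l ≠ k :=
    (by decide : ∀ k : Fin 7, ∃ l : Fin 7, l ≠ 0 ∧ l ≠ 1 ∧ l ≠ k) k
  obtain ⟨p, hp0, hpl, hp⟩ := hS.exists_third hl0.symm
  obtain ⟨q, hq1, hql, hq⟩ := hS.exists_third hl1.symm
  obtain ⟨r, hrk, hrl, hr⟩ := hS.exists_third hlk.symm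
  have hl01 : l ∉ ({0, 1, k} : Finset (Fin 7)) := by simp [hl0, hl1, hlk]
  have out : ∀ {x y : Fin 7}, x ∈ ({0, 1, k} : Finset (Fin 7)) → {x, l, y} ∈ S → y ≠ x →
      y ∉ ({0, 1, k} : Finset (Fin 7)) := by
    intro x y hx hy hyx hmem
    have := eqm hy hk hyx (by simp) (by simp) hmem hx
    exact hl01 (this ▸ (by simp))
  have hpk := out (by simp) hp hp0
  have hqk := out (by simp) hq hq1
  have hrk' := out (by simp) hr hrk
  have ne : ∀ {x y z : Fin 7}, x ∈ ({0, 1, k} : Finset (Fin 7)) →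
      y ∈ ({0, 1, k} : Finset (Fin 7)) → x ≠ y → {x, l, z} ∈ S → z ≠ l → {y, l, z} ∉ S := by
    intro x y z hx hy hxy hxz hzl hyz
    have := eqm hxz hyz hzl (by simp) (by simp) (by simp) (by simp)
    have hxm : y ∈ ({x, l, z} : Finset (Fin 7)) := by rw [this]; simp
    have := eqm hxz hk hxy (by simp) hxm hx hy
    exact hl01 (this ▸ (by simp))
  have hpq : p ≠ q := by
    rintro rfl; exact ne (x := 0) (y := 1) (by simp) (by simp) h01 hp hpl hq
  have hpr : p ≠ r := by
    rintro rfl; exact ne (x := 0) (y := k) (by simp) (by simp) hk0.symm hp hpl hr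
  have hqr : q ≠ r := by
    rintro rfl; exact ne (x := 1) (y := k) (by simp) (by simp) hk1.symm hq hql hr
  simp only [Finset.mem_insert, Finset.mem_singleton, not_or] at hpk hqk hrk'
  let f : Fin 7 → Fin 7 := ![0, 1, k, l, p, q, r]
  have hf : Function.Injective f := by
    intro i j
    fin_cases i <;> fin_cases j <;> simp [f] <;> grind
  have hfb := Finite.injective_iff_bijective.mp hf
  let σ : Equiv.Perm (Fin 7) := Equiv.ofBijective f hfb
  refine ⟨σ, ((stdPlane_isFanoPlane.smul σ).eq_of_subset hS ?_).symm⟩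
  have hsurj : ∀ m : Fin 7, m = 0 ∨ m = 1 ∨ m = k ∨ m = l ∨ m = p ∨ m = q ∨ m = r := by
    intro m
    obtain ⟨i, rfl⟩ := hfb.2 m
    fin_cases i <;> simp [f]
  -- A wrong third point m lies on a known line through exactly one of x and y; that line would
  -- share two points with the line through x and y, hence equal it.
  have third : ∀ {x y : Fin 7}, x ≠ y → ∀ z : Fin 7, (∀ m, m ≠ x → m ≠ y → m ≠ z →
      ∃ L ∈ S, m ∈ L ∧ ((x ∈ L ∧ y ∉ L) ∨ (y ∈ L ∧ x ∉ L))) → {x, y, z} ∈ S := by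
    intro x y hxy z hz
    obtain ⟨m, hmx, hmy, hm⟩ := hS.exists_third hxy
    by_cases hmz : m = z
    · rwa [← hmz]
    exfalso
    obtain ⟨L, hL, hmL, ⟨h1, h2⟩ | ⟨h1, h2⟩⟩ := hz m hmx hmy hmz
    · exact h2 (eqm hL hm hmx hmL h1 (by simp) (by simp) ▸ (by simp))
    · exact h2 (eqm hL hm hmy hmL h1 (by simp) (by simp) ▸ (by simp))
  have h056 : {0, q, r} ∈ S := by
    refine third (Ne.symm hqk.1) r fun m h1 h2 h3 => ?_
    rcases hsurj m with rfl | rfl | rfl | rfl | rfl | rfl | rfl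
    · exact absurd rfl h1
    · exact ⟨_, hk, by simp, .inl ⟨by simp, by simp [hqk]⟩⟩
    · exact ⟨_, hk, by simp, .inl ⟨by simp, by simp [hqk]⟩⟩
    · exact ⟨_, hp, by simp, .inl ⟨by simp, by simp [hqk, hql, hpq.symm]⟩⟩
    · exact ⟨_, hp, by simp, .inl ⟨by simp, by simp [hqk, hql, hpq.symm]⟩⟩
    · exact absurd rfl h2
    · exact absurd rfl h3
  have h146 : {1, p, r} ∈ S := by
    refine third (Ne.symm hpk.2.1) r fun m h1 h2 h3 => ?_
    rcases hsurj m with rfl | rfl | rfl | rfl | rfl | rfl | rfl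
    · exact ⟨_, hk, by simp, .inl ⟨by simp, by simp [hpk]⟩⟩
    · exact absurd rfl h1
    · exact ⟨_, hk, by simp, .inl ⟨by simp, by simp [hpk]⟩⟩
    · exact ⟨_, hq, by simp, .inl ⟨by simp, by simp [hpk, hpl, hpq]⟩⟩
    · exact absurd rfl h2
    · exact ⟨_, hq, by simp, .inl ⟨by simp, by simp [hpk, hpl, hpq]⟩⟩
    · exact absurd rfl h3
  have h245 : {k, p, q} ∈ S := by
    refine third (Ne.symm hpk.2.2) q fun m h1 h2 h3 => ?_
    rcases hsurj m with rfl | rfl | rfl | rfl | rfl | rfl | rfl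
    · exact ⟨_, hk, by simp, .inl ⟨by simp, by simp [hpk]⟩⟩
    · exact ⟨_, hk, by simp, .inl ⟨by simp, by simp [hpk]⟩⟩
    · exact absurd rfl h1
    · exact ⟨_, hr, by simp, .inl ⟨by simp, by simp [hpk, hpl, hpr]⟩⟩
    · exact absurd rfl h2
    · exact absurd rfl h3
    · exact ⟨_, hr, by simp, .inl ⟨by simp, by simp [hpk, hpl, hpr]⟩⟩
  have himg : ∀ a b c : Fin 7, σ • ({a, b, c} : Finset (Fin 7)) = {f a, f b, f c} := by
    intro a b c
    simp [Finset.smul_finset_insert, σ]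
  intro L hL
  obtain ⟨M, hM, rfl⟩ := Finset.mem_smul_finset.mp hL
  simp only [stdPlane, Finset.mem_insert, Finset.mem_singleton] at hM
  rcases hM with rfl | rfl | rfl | rfl | rfl | rfl | rfl <;> rw [himg] <;> simp only [f]
  exacts [hk, hp, hq, hr, h056, h146, h245]

theorem stdPlane_card_inter :
    ∀ L ∈ stdPlane, ∀ M ∈ stdPlane, L ≠ M → (L ∩ M).card = 1 := by decide +kernel

theorem stdPlane_card : stdPlane.card = 7 := by decide +kernel

/-- Any two lines of a Fano plane meet in exactly one point. -/
theorem IsFanoPlane.card_inter {S : Finset (Finset (Fin 7))} (hS : IsFanoPlane S)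
    {L M : Finset (Fin 7)} (hL : L ∈ S) (hM : M ∈ S) (hne : L ≠ M) : (L ∩ M).card = 1 := by
  obtain ⟨σ, hσ⟩ := hS.exists_smul
  rw [hσ, ← Finset.inv_smul_mem_iff] at hL hM
  rw [← Finset.card_smul_finset σ⁻¹, Finset.smul_finset_inter]
  exact stdPlane_card_inter _ hL _ hM fun h => hne (smul_left_cancel _ h)

theorem IsFanoPlane.card_eq {S : Finset (Finset (Fin 7))} (hS : IsFanoPlane S) : S.card = 7 := by
  obtain ⟨σ, hσ⟩ := hS.exists_smul
  rw [hσ, Finset.card_smul_finset, stdPlane_card]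

/-! ### Fano planes as sets of singular bivectors -/

namespace Biv

variable {k : Fin 8 → Biv}

/-- The bivectors attached to a set of lines, together with zero. -/
def planeSet (k : Fin 8 → Biv) (S : Finset (Finset (Fin 7))) : Finset Biv :=
  insert 0 (S.image (lineSum k))

theorem IsClique.lineSum_ne_zero (hk : IsClique k) (h0 : k 0 = 0) {L : Finset (Fin 7)}
    (hL : L.card = 3) : lineSum k L ≠ 0 := by
  intro h
  rcases hk.eq_empty_or_univ h0 h with rfl | rfl <;> simp at hL

theorem IsClique.pf_lineSum_of_card (hk : IsClique k) (h0 : k 0 = 0) {L : Finset (Fin 7)}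
    (hL : L.card = 3) : pf (lineSum k L) = 0 := by
  rw [hk.pf_lineSum h0, hL]; decide

theorem card_symmDiff_of_card_eq_three {L M : Finset (Fin 7)} (hL : L.card = 3)
    (hM : M.card = 3) : (symmDiff L M).card + 2 * (L ∩ M).card = 6 := by
  rw [symmDiff_def, Finset.sup_eq_union, Finset.card_union_of_disjoint disjoint_sdiff_sdiff]
  have h1 := Finset.card_sdiff_add_card_inter L M
  have h2 := Finset.card_sdiff_add_card_inter M L
  rw [Finset.inter_comm] at h2
  omega

/-- Only the size of the symmetric difference matters. For distinct triples it is 6, 4 or 2, with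
Pfaffian C(7,2), C(5,2) or C(3,2) modulo two, and only C(5,2) = 10 is even. -/
theorem IsClique.pf_lineSum_add (hk : IsClique k) (h0 : k 0 = 0) {L M : Finset (Fin 7)}
    (hL : L.card = 3) (hM : M.card = 3) :
    pf (lineSum k L + lineSum k M) = 0 ↔ L = M ∨ (L ∩ M).card = 1 := by
  rw [lineSum_symmDiff, hk.pf_lineSum h0]
  have h1 := card_symmDiff_of_card_eq_three hL hM
  have h2 : (L ∩ M).card ≤ 3 := hL ▸ Finset.card_le_card Finset.inter_subset_left
  by_cases hLM : L = M
  · subst hLM; simp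
  have h3 : (L ∩ M).card ≠ 3 := by
    intro h3
    have e1 := Finset.eq_of_subset_of_card_le (Finset.inter_subset_left : L ∩ M ⊆ L) (by omega)
    have e2 := Finset.eq_of_subset_of_card_le (Finset.inter_subset_right : L ∩ M ⊆ M) (by omega)
    exact hLM (e1.symm.trans e2)
  simp only [hLM, false_or]
  have : (L ∩ M).card = 0 ∨ (L ∩ M).card = 1 ∨ (L ∩ M).card = 2 := by omega
  rcases this with h | h | h
  · rw [h, show (symmDiff L M).card = 6 by omega]; decide
  · rw [h, show (symmDiff L M).card = 4 by omega]; decide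
  · rw [h, show (symmDiff L M).card = 2 by omega]; decide

theorem IsClique.pf_add_of_mem_planeSet (hk : IsClique k) (h0 : k 0 = 0)
    {S : Finset (Finset (Fin 7))} (hS : IsFanoPlane S) {x y : Biv} (hx : x ∈ planeSet k S)
    (hy : y ∈ planeSet k S) : pf (x + y) = 0 := by
  simp only [planeSet, Finset.mem_insert, Finset.mem_image] at hx hy
  rcases hx with rfl | ⟨L, hL, rfl⟩ <;> rcases hy with rfl | ⟨M, hM, rfl⟩
  · simp [pf_zero]
  · rw [zero_add]; exact hk.pf_lineSum_of_card h0 (hS.1 _ hM)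
  · rw [add_zero]; exact hk.pf_lineSum_of_card h0 (hS.1 _ hL)
  · rw [hk.pf_lineSum_add h0 (hS.1 _ hL) (hS.1 _ hM)]
    by_cases h : L = M
    · exact .inl h
    · exact .inr (hS.card_inter hL hM h)

theorem IsClique.card_planeSet (hk : IsClique k) (h0 : k 0 = 0)
    {S : Finset (Finset (Fin 7))} (hS : IsFanoPlane S) : (planeSet k S).card = 8 := by
  rw [planeSet, Finset.card_insert_of_notMem, Finset.card_image_of_injOn, hS.card_eq]
  · intro L hL M hM h
    exact hk.lineSum_inj h0 (hS.1 _ hL).le (hS.1 _ hM).le h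
  · simp only [Finset.mem_image, not_exists, not_and]
    exact fun L hL => hk.lineSum_ne_zero h0 (hS.1 _ hL)

/-- Eight bivectors with pairwise singular sums tile the space together with a clique. -/
theorem IsClique.exists_add (hk : IsClique k) {V : Finset Biv} (hV : V.card = 8)
    (hpf : ∀ x ∈ V, ∀ y ∈ V, pf (x + y) = 0) (z : Biv) : ∃ i, ∃ x ∈ V, z = k i + x := by
  -- A collision would equate a nonsingular sum of two clique members with a singular sum from V;
  -- then 8 · 8 = 64 gives surjectivity.
  let f : Fin 8 × V → Biv := fun p => k p.1 + p.2
  have hinj : Function.Injective f := by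
    rintro ⟨i, x, hx⟩ ⟨j, y, hy⟩ h
    simp only [f] at h
    have h' : k i + k j = x + y := by
      have := congrArg (fun z => z + k j + x) h
      beta_reduce at this
      rw [add_right_comm _ x, add_add_cancel] at this
      rw [this, add_comm (k j), add_add_cancel, add_comm]
    by_cases hij : i = j
    · subst hij
      rw [add_self, eq_comm, add_eq_zero_iff] at h'
      subst h'; rfl
    · have h1 := hk i j hij
      rw [h', hpf x hx y hy] at h1
      exact absurd h1 zero_ne_one
  have hcard : Fintype.card (Fin 8 × V) = Fintype.card Biv := by
    rw [Fintype.card_prod, Fintype.card_coe, hV]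
    simp
  obtain ⟨⟨i, x, hx⟩, h⟩ := ((Fintype.bijective_iff_injective_and_card f).mpr ⟨hinj, hcard⟩).2 z
  exact ⟨i, x, hx, h.symm⟩

/-- The triples of points whose bivectors lie in `V`. -/
noncomputable def triplesIn (k : Fin 8 → Biv) (V : Set Biv) : Finset (Finset (Fin 7)) :=
  open Classical in Finset.univ.filter fun L => L.card = 3 ∧ lineSum k L ∈ V

theorem mem_triplesIn {V : Set Biv} {L : Finset (Fin 7)} :
    L ∈ triplesIn k V ↔ L.card = 3 ∧ lineSum k L ∈ V := by
  simp [triplesIn]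

/-- Existence of lines is covering: `k i.succ + k j.succ` lies in some `k m + V`, and m must be a
third point, since otherwise V would contain a nonsingular element. Uniqueness is singularity of
sums: distinct triples share only one point. -/
theorem IsClique.triplesIn_isFanoPlane (hk : IsClique k) (h0 : k 0 = 0) {V : Set Biv}
    (hV0 : 0 ∈ V) (hpf : ∀ x ∈ V, ∀ y ∈ V, pf (x + y) = 0)
    (hcov : ∀ z, ∃ i, ∃ x ∈ V, z = k i + x) : IsFanoPlane (triplesIn k V) := by
  refine ⟨fun L hL => (mem_triplesIn.mp hL).1, fun i j hij => ?_⟩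
  have hpf0 : ∀ x ∈ V, pf x = 0 := fun x hx => by simpa using hpf x hx 0 hV0
  have hne : ∀ x ∈ V, pf x ≠ 1 := fun x hx h => by
    rw [hpf0 x hx] at h; exact zero_ne_one h
  obtain ⟨m, x, hx, hz⟩ := hcov (k i.succ + k j.succ)
  have hx' : x = k i.succ + k j.succ + k m := by rw [hz, add_comm (k m), add_add_cancel]
  have hm0 : m ≠ 0 := by
    rintro rfl
    apply hne x hx
    rw [hx', h0, add_zero]
    exact hk _ _ (by simpa using hij)
  obtain ⟨m, rfl⟩ := Fin.exists_succ_eq.mpr hm0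
  have hmi : m ≠ i := by
    rintro rfl
    apply hne x hx
    rw [hx', add_comm (k _), add_add_cancel]
    exact hk.pf_succ h0 j
  have hmj : m ≠ j := by
    rintro rfl
    apply hne x hx
    rw [hx', add_add_cancel]
    exact hk.pf_succ h0 i
  have hL : ({i, j, m} : Finset (Fin 7)) ∈ triplesIn k V := by
    rw [mem_triplesIn]
    refine ⟨Finset.card_eq_three.mpr ⟨i, j, m, hij, hmi.symm, hmj.symm, rfl⟩, ?_⟩
    have : lineSum k {i, j, m} = x := by
      rw [hx', lineSum, Finset.sum_insert (by simp [hij, hmi.symm]),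
        Finset.sum_pair hmj.symm, add_assoc]
    rwa [this]
  refine ⟨{i, j, m}, ⟨hL, by simp, by simp⟩, ?_⟩
  rintro M ⟨hM, hiM, hjM⟩
  have hL' := mem_triplesIn.mp hL
  have hM' := mem_triplesIn.mp hM
  have h1 := hpf _ hM'.2 _ hL'.2
  rw [hk.pf_lineSum_add h0 hM'.1 hL'.1] at h1
  refine h1.resolve_right fun h1 => ?_
  have : 1 < (M ∩ {i, j, m}).card :=
    Finset.one_lt_card.mpr ⟨i, by simp [hiM], j, by simp [hjM], hij⟩
  omega

theorem IsClique.mem_planeSet_triplesIn (hk : IsClique k) (h0 : k 0 = 0) {V : Set Biv}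
    (hV0 : 0 ∈ V) (hpf : ∀ x ∈ V, pf x = 0) {x : Biv} :
    x ∈ planeSet k (triplesIn k V) ↔ x ∈ V := by
  simp only [planeSet, Finset.mem_insert, Finset.mem_image, mem_triplesIn]
  constructor
  · rintro (rfl | ⟨L, ⟨-, hL⟩, rfl⟩)
    · exact hV0
    · exact hL
  · intro hx
    by_cases hx0 : x = 0
    · exact .inl hx0
    · obtain ⟨L, hL, rfl⟩ := hk.exists_triple h0 (hpf x hx) hx0
      exact .inr ⟨L, ⟨hL, hx⟩, rfl⟩

/-! ### Annihilators, the two types of Fano planes, and the orbits of A_7 -/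

/-- The product of a vector with a bivector (`b = false`) or with its complement (`b = true`). -/
def actOf (b : Bool) (x : Biv) (v : Vec) : Vec := act (bif b then star x else x) v

theorem actOf_add (b : Bool) (x y : Biv) (v : Vec) :
    actOf b (x + y) v = actOf b x v + actOf b y v := by
  cases b <;> simp [actOf, act_add, star_add]

theorem actOf_zero (b : Bool) (v : Vec) : actOf b 0 v = 0 := by
  cases b <;> simp [actOf, act_zero, star_zero]

theorem actOf_smul (b : Bool) (c : ZMod 2) (x : Biv) (v : Vec) :
    actOf b (c • x) v = c • actOf b x v := by
  obtain rfl | rfl : c = 0 ∨ c = 1 := by revert c; decide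
  · simp [actOf_zero]
  · simp

theorem actOf_zero_right (b : Bool) (x : Biv) : actOf b x 0 = 0 := by
  cases b <;> simp [actOf, act_zero_right]

theorem actOf_not_actOf (b : Bool) (x : Biv) (v : Vec) :
    actOf (!b) x (actOf b x v) = pf x • v := by
  cases b
  · simp [actOf, act_star_act]
  · have := act_star_act (star x) v
    rw [star_star, pf_star] at this
    simpa [actOf] using this

theorem actOf_not_actOf_comm (b : Bool) {x : Biv} (c : Biv) {v : Vec} (h : actOf b x v = 0) :
    actOf (!b) x (actOf b c v) = polar x c • v := by
  cases b
  · simp only [actOf, Bool.not_false, cond_false, cond_true] at *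
    rw [act_star_act_comm, h, act_zero_right, add_zero]
  · simp only [actOf, Bool.not_true, cond_false, cond_true] at *
    have := act_star_act_comm (star x) (star c) v
    rwa [star_star, star_star, polar_star, h, act_zero_right, add_zero] at this

theorem pf_eq_zero_of_actOf {b : Bool} {x : Biv} {v : Vec} (hv : v ≠ 0) (h : actOf b x v = 0) :
    pf x = 0 := by
  have := actOf_not_actOf b x v
  rw [h, actOf_zero_right, eq_comm, smul_eq_zero] at this
  exact this.resolve_right hv

theorem card_act_eq_zero : ∀ v : Vec, v ≠ 0 →
    (Finset.univ.filter fun x : Biv => act x v = 0).card = 8 := by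
  decide +kernel

theorem card_actOf_eq_zero (b : Bool) {v : Vec} (hv : v ≠ 0) :
    (Finset.univ.filter fun x : Biv => actOf b x v = 0).card = 8 := by
  cases b
  · exact card_act_eq_zero v hv
  · rw [← card_act_eq_zero v hv]
    refine Finset.card_bij (fun x _ => star x) ?_ ?_ ?_
    · intro x hx; exact Finset.mem_filter.mpr ⟨Finset.mem_univ _, (Finset.mem_filter.mp hx).2⟩
    · intro x _ y _ h; rw [← star_star x, h, star_star]
    · intro x hx;
      refine ⟨star x, Finset.mem_filter.mpr ⟨Finset.mem_univ _, ?_⟩, star_star x⟩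
      simpa only [actOf, cond_true, star_star] using (Finset.mem_filter.mp hx).2

theorem act_determines : ∀ v : Vec, v ≠ 0 → ∀ w : Vec, w ≠ 0 →
    (∀ x : Biv, act x v = 0 → act x w = 0) → v = w := by
  decide +kernel

/-- This separates the two families of annihilators, so that no Fano plane has both types. -/
theorem exists_act_eq_zero_act_star_ne_zero : ∀ v : Vec, ∀ w : Vec, w ≠ 0 →
    ∃ x : Biv, act x v = 0 ∧ act (star x) w ≠ 0 := by
  decide +kernel

theorem actOf_determines (b : Bool) {v w : Vec} (hv : v ≠ 0) (hw : w ≠ 0)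
    (h : ∀ x : Biv, actOf b x v = 0 → actOf b x w = 0) : v = w := by
  cases b
  · exact act_determines v hv w hw h
  · refine act_determines v hv w hw fun x hx => ?_
    have := h (star x)
    simp only [actOf, cond_true, star_star] at this
    exact this hx

/-- The bivectors annihilated by `v`, in the sense of `actOf`. -/
def annih (b : Bool) (v : Vec) : Set Biv := {x | actOf b x v = 0}

theorem zero_mem_annih (b : Bool) (v : Vec) : 0 ∈ annih b v := actOf_zero b v

theorem pf_add_of_mem_annih {b : Bool} {v : Vec} (hv : v ≠ 0) {x y : Biv} (hx : x ∈ annih b v)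
    (hy : y ∈ annih b v) : pf (x + y) = 0 := by
  apply pf_eq_zero_of_actOf (b := b) hv
  rw [actOf_add, hx, hy, add_zero]

theorem pf_of_mem_annih {b : Bool} {v : Vec} (hv : v ≠ 0) {x : Biv} (hx : x ∈ annih b v) :
    pf x = 0 := pf_eq_zero_of_actOf hv hx

theorem IsClique.triplesIn_annih_isFanoPlane (hk : IsClique k) (h0 : k 0 = 0) (b : Bool)
    {v : Vec} (hv : v ≠ 0) : IsFanoPlane (triplesIn k (annih b v)) := by
  refine hk.triplesIn_isFanoPlane h0 (zero_mem_annih b v)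
    (fun x hx y hy => pf_add_of_mem_annih hv hx hy) fun z => ?_
  obtain ⟨i, x, hx, h⟩ := hk.exists_add (card_actOf_eq_zero b hv)
    (fun x hx y hy => pf_add_of_mem_annih (b := b) hv (by simpa [annih] using hx)
      (by simpa [annih] using hy)) z
  exact ⟨i, x, by simpa [annih] using hx, h⟩

/-- The two types of Fano planes with respect to a clique. -/
def HasType (k : Fin 8 → Biv) (b : Bool) (S : Finset (Finset (Fin 7))) : Prop :=
  ∃ v : Vec, v ≠ 0 ∧ S = triplesIn k (annih b v)

theorem IsClique.hasType_of_forall (hk : IsClique k) (h0 : k 0 = 0) {b : Bool}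
    {S : Finset (Finset (Fin 7))} (hS : IsFanoPlane S) {v : Vec} (hv : v ≠ 0)
    (h : ∀ L ∈ S, actOf b (lineSum k L) v = 0) : HasType k b S :=
  ⟨v, hv, hS.eq_of_subset (hk.triplesIn_annih_isFanoPlane h0 b hv)
    fun L hL => mem_triplesIn.mpr ⟨hS.1 L hL, h L hL⟩⟩

theorem IsClique.annih_subset (hk : IsClique k) (h0 : k 0 = 0) {b c : Bool} {v w : Vec}
    (hv : v ≠ 0) (h : triplesIn k (annih b v) = triplesIn k (annih c w)) :
    annih b v ⊆ annih c w := by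
  intro x hx
  by_cases hx0 : x = 0
  · rw [hx0]; exact zero_mem_annih c w
  obtain ⟨L, hL, rfl⟩ := hk.exists_triple h0 (pf_of_mem_annih hv hx) hx0
  have : L ∈ triplesIn k (annih c w) := by
    rw [← h]; exact mem_triplesIn.mpr ⟨hL, hx⟩
  exact (mem_triplesIn.mp this).2

theorem IsClique.triplesIn_annih_inj (hk : IsClique k) (h0 : k 0 = 0) {b : Bool} {v w : Vec}
    (hv : v ≠ 0) (hw : w ≠ 0) (h : triplesIn k (annih b v) = triplesIn k (annih b w)) : v = w :=
  actOf_determines b hv hw fun _ hx => hk.annih_subset h0 hv h hx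

theorem IsClique.not_hasType_not (hk : IsClique k) (h0 : k 0 = 0) {b : Bool}
    {S : Finset (Finset (Fin 7))} (h₁ : HasType k b S) : ¬ HasType k (!b) S := by
  have key : HasType k false S → HasType k true S → False := by
    rintro ⟨v, hv, rfl⟩ ⟨w, hw, h⟩
    obtain ⟨x, hx, hx'⟩ := exists_act_eq_zero_act_star_ne_zero v w hw
    exact hx' (hk.annih_subset h0 hv h hx)
  intro h₂
  cases b
  · exact key h₁ h₂
  · exact key h₂ h₁

/-- The reflection in `k i.succ + k j.succ` exchanges these two members and fixes the other five,
whose polar products with both are one. Linearity extends this to sums. -/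
theorem IsClique.lineSum_swap (hk : IsClique k) (h0 : k 0 = 0) {i j : Fin 7} (hij : i ≠ j)
    (L : Finset (Fin 7)) : lineSum k (Equiv.swap i j • L) = lineSum k L +
      polar (lineSum k L) (k i.succ + k j.succ) • (k i.succ + k j.succ) := by
  have hpt : ∀ x : Fin 7, k (Equiv.swap i j x).succ = k x.succ +
      polar (k x.succ) (k i.succ + k j.succ) • (k i.succ + k j.succ) := by
    intro x
    rw [polar_add_right]
    by_cases hxi : x = i
    · subst hxi
      rw [polar_self, hk.polar_succ h0 hij, Equiv.swap_apply_left, zero_add, one_smul,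
        ← add_assoc, add_self, zero_add]
    by_cases hxj : x = j
    · subst hxj
      rw [polar_self, hk.polar_succ h0 hij.symm, Equiv.swap_apply_right, add_zero, one_smul,
        add_comm (k i.succ), ← add_assoc, add_self, zero_add]
    · rw [hk.polar_succ h0 hxi, hk.polar_succ h0 hxj, Equiv.swap_apply_of_ne_of_ne hxi hxj,
        show (1 + 1 : ZMod 2) = 0 by decide, zero_smul, add_zero]
  have hsum : lineSum k (Equiv.swap i j • L) = ∑ x ∈ L, k (Equiv.swap i j x).succ := by
    rw [lineSum, Finset.smul_finset_def, Finset.sum_image]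
    · rfl
    · intro x _ y _ h; exact (Equiv.swap i j).injective h
  rw [hsum]
  clear hsum
  induction L using Finset.induction_on with
  | empty => simp [lineSum, polar_zero_left]
  | insert x L hx ih =>
    rw [Finset.sum_insert hx, ih, hpt, lineSum, lineSum, Finset.sum_insert hx, polar_add_left,
      add_smul]
    abel

/-- The reflection in c carries the annihilator of v to the annihilator, in the other family, of c
applied to v. By `actOf_not_actOf_comm` the two resulting multiples of v cancel; the new vector is
nonzero because c is nonsingular. -/
theorem IsClique.hasType_swap (hk : IsClique k) (h0 : k 0 = 0) {b : Bool}
    {S : Finset (Finset (Fin 7))} (hS : IsFanoPlane S) (h : HasType k b S) {i j : Fin 7}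
    (hij : i ≠ j) : HasType k (!b) (Equiv.swap i j • S) := by
  obtain ⟨v, hv, hSv⟩ := h
  set c := k i.succ + k j.succ with hc
  have hpc : pf c = 1 := hk _ _ (by simpa using hij)
  have hcv : actOf (!b) c (actOf b c v) = v := by rw [actOf_not_actOf, hpc, one_smul]
  refine hk.hasType_of_forall h0 (hS.smul _) (v := actOf b c v) ?_ ?_
  · intro h
    rw [h, actOf_zero_right] at hcv
    exact hv hcv.symm
  · intro L hL
    obtain ⟨M, hM, rfl⟩ := Finset.mem_smul_finset.mp hL
    rw [hSv] at hM
    rw [hk.lineSum_swap h0 hij, ← hc, actOf_add, actOf_smul, hcv,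
      actOf_not_actOf_comm b c (mem_triplesIn.mp hM).2, ← add_smul, CharTwo.add_self_eq_zero,
      zero_smul]

theorem IsClique.hasType_smul (hk : IsClique k) (h0 : k 0 = 0) (σ : Equiv.Perm (Fin 7)) :
    ∀ {b : Bool} {S : Finset (Finset (Fin 7))}, IsFanoPlane S → HasType k b S →
      HasType k (bif decide (Equiv.Perm.sign σ = 1) then b else !b) (σ • S) := by
  induction σ using Equiv.Perm.swap_induction_on with
  | one => intro b S _ h; simpa using h
  | swap_mul f x y hxy ih =>
    intro b S hS h
    have := hk.hasType_swap h0 (hS.smul f) (ih hS h) hxy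
    rw [← mul_smul] at this
    convert this using 1
    rw [Equiv.Perm.sign_mul, Equiv.Perm.sign_swap hxy]
    rcases Int.units_eq_one_or (Equiv.Perm.sign f) with h | h <;> simp [h]

/-- All Fano planes are relabellings of one plane that has a type, and relabelling keeps or switches
types. The all-ones vector is an arbitrary nonzero choice. -/
theorem IsClique.exists_hasType (hk : IsClique k) (h0 : k 0 = 0)
    {S : Finset (Finset (Fin 7))} (hS : IsFanoPlane S) : ∃ b, HasType k b S := by
  have hv : (fun _ => 1 : Vec) ≠ 0 := by decide
  have h1 := hk.triplesIn_annih_isFanoPlane h0 true hv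
  obtain ⟨σ, hσ⟩ := h1.exists_smul
  obtain ⟨ρ, hρ⟩ := hS.exists_smul
  have : S = (ρ * σ⁻¹) • triplesIn k (annih true fun _ => 1) := by
    rw [hρ, hσ, smul_smul, inv_mul_cancel_right]
  rw [this]
  exact ⟨_, hk.hasType_smul h0 _ h1 ⟨_, hv, rfl⟩⟩

theorem mem_a7Orbit {S T : Finset (Finset (Fin 7))} :
    T ∈ a7Orbit S ↔ ∃ σ : Equiv.Perm (Fin 7), Equiv.Perm.sign σ = 1 ∧ σ • S = T := by
  constructor
  · rintro ⟨⟨σ, hσ⟩, rfl⟩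
    exact ⟨σ, Equiv.Perm.mem_alternatingGroup.mp hσ, rfl⟩
  · rintro ⟨σ, hσ, rfl⟩
    exact ⟨⟨σ, Equiv.Perm.mem_alternatingGroup.mpr hσ⟩, rfl⟩

/-- The `A₇`-orbit of a Fano plane consists of the Fano planes of the same type. -/
theorem IsClique.mem_a7Orbit_iff (hk : IsClique k) (h0 : k 0 = 0) {b : Bool}
    {S T : Finset (Finset (Fin 7))} (hS : IsFanoPlane S) (hb : HasType k b S) :
    T ∈ a7Orbit S ↔ HasType k b T := by
  rw [mem_a7Orbit]
  constructor
  · rintro ⟨σ, hσ, rfl⟩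
    simpa [hσ] using hk.hasType_smul h0 σ hS hb
  · intro hT
    have hTF : IsFanoPlane T := by
      obtain ⟨v, hv, rfl⟩ := hT
      exact hk.triplesIn_annih_isFanoPlane h0 b hv
    obtain ⟨σ, hσ⟩ := hS.exists_smul
    obtain ⟨ρ, hρ⟩ := hTF.exists_smul
    have hTS : (ρ * σ⁻¹) • S = T := by rw [hρ, hσ, smul_smul, inv_mul_cancel_right]
    refine ⟨ρ * σ⁻¹, ?_, hTS⟩
    have h := hk.hasType_smul h0 (ρ * σ⁻¹) hS hb
    rw [hTS] at h
    -- An odd relabelling would give T the opposite type as well.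
    by_contra hne
    simp only [hne, decide_false, cond_false] at h
    exact hk.not_hasType_not h0 hT h

theorem IsClique.ncard_hasType (hk : IsClique k) (h0 : k 0 = 0) (b : Bool) :
    {S | HasType k b S}.ncard = 15 := by
  have : {S | HasType k b S} = (fun v => triplesIn k (annih b v)) '' {v : Vec | v ≠ 0} := by
    ext S
    constructor
    · rintro ⟨v, hv, rfl⟩; exact ⟨v, hv, rfl⟩
    · rintro ⟨v, hv, rfl⟩; exact ⟨v, hv, rfl⟩
  rw [this, Set.InjOn.ncard_image]
  · have : {v : Vec | v ≠ 0} = ((Finset.univ.erase 0 : Finset Vec) : Set Vec) := by ext; simp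
    rw [this, Set.ncard_coe_finset, Finset.card_erase_of_mem (Finset.mem_univ _)]
    simp
  · intro v hv w hw h
    exact hk.triplesIn_annih_inj h0 hv hw h

/-- The Fano planes form two `A₇`-orbits of fifteen planes each. -/
theorem IsClique.fano_orbits (hk : IsClique k) (h0 : k 0 = 0) :
    ∃ S T : Finset (Finset (Fin 7)), IsFanoPlane S ∧ IsFanoPlane T ∧
      Disjoint (a7Orbit S) (a7Orbit T) ∧ {F | IsFanoPlane F} = a7Orbit S ∪ a7Orbit T ∧
      (a7Orbit S).ncard = 15 ∧ (a7Orbit T).ncard = 15 := by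
  have hv : (fun _ => 1 : Vec) ≠ 0 := by decide
  have hF : ∀ b S, HasType k b S → IsFanoPlane S := by
    rintro b S ⟨v, hv, rfl⟩
    exact hk.triplesIn_annih_isFanoPlane h0 b hv
  have horb : ∀ b, a7Orbit (triplesIn k (annih b fun _ => 1)) = {S | HasType k b S} := by
    intro b
    ext S
    exact hk.mem_a7Orbit_iff h0 (hk.triplesIn_annih_isFanoPlane h0 b hv) ⟨_, hv, rfl⟩
  refine ⟨triplesIn k (annih true fun _ => 1), triplesIn k (annih false fun _ => 1),
    hk.triplesIn_annih_isFanoPlane h0 _ hv, hk.triplesIn_annih_isFanoPlane h0 _ hv, ?_, ?_, ?_, ?_⟩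
  · rw [horb, horb, Set.disjoint_left]
    exact fun S h1 h2 => hk.not_hasType_not h0 h1 h2
  · rw [horb, horb]
    ext S
    constructor
    · intro hS
      obtain ⟨b, hb⟩ := hk.exists_hasType h0 hS
      cases b
      · exact .inr hb
      · exact .inl hb
    · rintro (h | h)
      · exact hF _ _ h
      · exact hF _ _ h
  · rw [horb]; exact hk.ncard_hasType h0 _
  · rw [horb]; exact hk.ncard_hasType h0 _

end Biv

/-! ### Shears acting on cliques and annihilators -/

namespace Biv

variable {k : Fin 8 → Biv}

theorem shear_zero_right (l u : Vec) : shear l u 0 = 0 := by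
  have := shear_add l u 0 0
  simpa using this

theorem dot_comm (u v : Vec) : dot u v = dot v u := by simp [dot]; ring

theorem dot_add_left (u v w : Vec) : dot (u + v) w = dot u w + dot v w := by
  simp [dot]; ring

theorem dot_zero_left (u : Vec) : dot 0 u = 0 := by simp [dot]

theorem shear_zero_left (u : Vec) (x : Biv) : shear 0 u x = x := by
  ext i; fin_cases i <;> simp [-Matrix.add_cons, shear, wedge, act_zero_right]

theorem IsClique.shear (hk : IsClique k) {l u : Vec} (h : dot l u = 0) :
    IsClique fun i => shear l u (k i) := by
  intro i j hij
  rw [← shear_add, pf_shear l u h]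
  exact hk i j hij

theorem wedge_self (u : Vec) : wedge u u = 0 := by
  ext i; fin_cases i <;> simp [wedge] <;> grind

theorem wedge_eq_zero : ∀ u : Vec, u ≠ 0 → ∀ w : Vec, wedge u w = 0 → w = 0 ∨ w = u := by
  decide +kernel

theorem exists_wedge_of_act_star : ∀ w : Vec, w ≠ 0 → ∀ x : Biv, act (star x) w = 0 →
    ∃ z, x = wedge w z := by
  decide +kernel

theorem exists_dot_eq_one : ∀ v : Vec, v ≠ 0 → ∀ w : Vec, w ≠ 0 →
    ∃ u, dot v u = 1 ∧ dot w u = 1 := by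
  decide +kernel

theorem act_ne_zero {x : Biv} (hx : pf x = 1) {v : Vec} (hv : v ≠ 0) : act x v ≠ 0 := by
  intro h
  rw [pf_eq_zero_of_actOf (b := false) hv h] at hx
  exact zero_ne_one hx

/-- A shear that fixes the member `k i` of a clique translates the clique by `k i`. -/
theorem IsClique.range_shear (hk : IsClique k) (h0 : k 0 = 0) {i : Fin 8} (hi : i ≠ 0) {l : Vec}
    (hl : l ≠ 0) : Set.range (fun j => Biv.shear l (act (k i) l) (k j)) =
      Set.range fun j => k j + k i := by
  set u := act (k i) l with hu
  have hpf : ∀ j, j ≠ 0 → pf (k j) = 1 := fun j hj => by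
    have := hk j 0 hj
    rwa [h0, add_zero] at this
  have hu0 : u ≠ 0 := act_ne_zero (hpf i hi) hl
  obtain ⟨m, hm⟩ := hk.range_eq_translate (hk.shear (dot_act_self (k i) l))
  rw [hm]
  obtain ⟨a, ha⟩ : ∃ a, k a + m = 0 := by
    have : (0 : Biv) ∈ Set.range fun j => k j + m := by
      rw [← hm]; exact ⟨0, by simp only [h0, shear_zero_right]⟩
    exact this
  rw [add_eq_zero_iff] at ha
  subst ha
  obtain ⟨b, hb⟩ : ∃ b, k b + k a = k i := by
    have : k i ∈ Set.range fun j => k j + k a := by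
      rw [← hm]
      refine ⟨i, ?_⟩
      change k i + wedge u u = k i
      rw [wedge_self, add_zero]
    exact this
  have hi0 : k i ≠ 0 := fun h => hi (hk.injective (h.trans h0.symm))
  -- If a = 0, the shear preserves the clique, and each member moves by a singular bivector, hence
  -- is fixed. Then `k j` maps l to 0 or to u, which makes `k j` or `k j + k i` singular.
  by_cases ha0 : a = 0
  · exfalso
    obtain ⟨j, hj0, hji⟩ := (by decide : ∀ i : Fin 8, ∃ j : Fin 8, j ≠ 0 ∧ j ≠ i) i
    obtain ⟨p, hp⟩ : ∃ p, k p + k a = Biv.shear l u (k j) := by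
      have : Biv.shear l u (k j) ∈ Set.range fun j => k j + k a := by
        rw [← hm]; exact ⟨j, rfl⟩
      exact this
    rw [ha0, h0, add_zero] at hp
    have hw : k j + k p = wedge u (act (k j) l) := by
      rw [hp, Biv.shear, ← add_assoc, add_self, zero_add]
    have hjp : j = p := by
      by_contra hne
      have := hk j p hne
      rw [hw, pf_wedge] at this
      exact zero_ne_one this
    rw [hjp, add_self] at hw
    rcases wedge_eq_zero u hu0 _ hw.symm with h | h
    · exact act_ne_zero (hpf p (hjp ▸ hj0)) hl h
    · refine act_ne_zero (hk p i (hjp ▸ hji)) hl ?_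
      rw [act_add, h, ← hu]
      ext; exact CharTwo.add_self_eq_zero _
  · by_cases hb0 : b = 0
    · rw [hb0, h0, zero_add] at hb
      rw [hb]
    · exfalso
      have hab : a ≠ b := by
        rintro rfl
        rw [add_self] at hb
        exact hi0 hb.symm
      refine hk.add_three_ne (Ne.symm hb0) (Ne.symm ha0) hab.symm i ?_
      rw [h0, zero_add, hb]

theorem shear_mem_annih_true {l u w : Vec} (hw : w ≠ 0) {x : Biv} (hx : x ∈ annih true w) :
    shear l u x ∈ annih true (w + dot l w • u) := by
  obtain ⟨z, rfl⟩ := exists_wedge_of_act_star w hw x hx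
  rw [shear_wedge]
  exact act_star_wedge _ _

theorem shear_mem_annih_false {l u h : Vec} (hl : dot l u = 0) {x : Biv} (hx : x ∈ annih false h) :
    shear l u x ∈ annih false (h + dot h u • l) := act_shear l u h hl x hx

theorem vec_add_add (v w : Vec) : v + (v + w) = w := by
  rw [← add_assoc]
  have : v + v = 0 := by ext; exact CharTwo.add_self_eq_zero _
  rw [this, zero_add]

/-- Choose u with v · u = w · u = 1. Then v + w is orthogonal to u, and adding (v · u)(v + w) to v
gives w. The first family transforms contragrediently, so there v + w is the covector l rather than
the direction. -/
theorem exists_shear_annih (b : Bool) {v w : Vec} (hv : v ≠ 0) (hw : w ≠ 0) :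
    ∃ l u, dot l u = 0 ∧ ∀ x ∈ annih b v, shear l u x ∈ annih b w := by
  obtain ⟨u, h1, h2⟩ := exists_dot_eq_one v hv w hw
  have h3 : dot (v + w) u = 0 := by rw [dot_add_left, h1, h2]; decide
  cases b
  · refine ⟨v + w, u, h3, fun x hx => ?_⟩
    have := shear_mem_annih_false h3 hx
    rwa [h1, one_smul, vec_add_add] at this
  · refine ⟨u, v + w, by rwa [dot_comm], fun x hx => ?_⟩
    have := shear_mem_annih_true (l := u) (u := v + w) hv hx
    rwa [dot_comm u v, h1, one_smul, vec_add_add] at this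

theorem shear_injective {l u : Vec} (h : dot l u = 0) : Function.Injective (shear l u) :=
  Function.LeftInverse.injective (g := shear l u) (shear_shear l u h)

theorem ncard_annih (b : Bool) {v : Vec} (hv : v ≠ 0) : (annih b v).ncard = 8 := by
  rw [← card_actOf_eq_zero b hv, ← Set.ncard_coe_finset]
  congr 1; ext; simp [annih]

theorem IsClique.exists_zero_of_range (hk : IsClique k) {k' : Fin 8 → Biv}
    (hk' : IsClique k') (h0' : k' 0 = 0) :
    ∃ a, Set.range k' = Set.range fun i => k i + k a := by
  obtain ⟨m, hm⟩ := hk.range_eq_translate hk'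
  have : (0 : Biv) ∈ Set.range fun i => k i + m := by
    rw [← hm]; exact ⟨0, h0'⟩
  obtain ⟨a, ha⟩ := this
  exact ⟨a, by rw [hm, add_eq_zero_iff.mp ha]⟩

/-- Some product of two shears stabilises a clique and maps a given annihilator to another. -/
theorem IsClique.exists_shear_shear (hk : IsClique k) (h0 : k 0 = 0) (b : Bool) {v w : Vec}
    (hv : v ≠ 0) (hw : w ≠ 0) : ∃ l₁ u₁ l₂ u₂, dot l₁ u₁ = 0 ∧ dot l₂ u₂ = 0 ∧
      Set.range (fun i => Biv.shear l₂ u₂ (Biv.shear l₁ u₁ (k i))) = Set.range k ∧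
      (fun x => Biv.shear l₂ u₂ (Biv.shear l₁ u₁ x)) '' annih b v = annih b w := by
  obtain ⟨l₁, u₁, h₁, hmap₁⟩ := exists_shear_annih b hv hw
  set k' : Fin 8 → Biv := fun i => Biv.shear l₁ u₁ (k i) with hk'def
  have hk' : IsClique k' := hk.shear h₁
  have h0' : k' 0 = 0 := by simp only [hk'def, h0, shear_zero_right]
  obtain ⟨a, ha⟩ := hk.exists_zero_of_range hk' h0'
  -- The first shear may send the clique to its translate by `k a`. A shear fixing `k' c = k a`
  -- translates it back, and its remaining freedom is spent on preserving the annihilator of w.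
  obtain ⟨l₂, u₂, h₂, hr, hmap₂⟩ : ∃ l₂ u₂, dot l₂ u₂ = 0 ∧
      Set.range (fun i => Biv.shear l₂ u₂ (k' i)) = Set.range k ∧
      ∀ x ∈ annih b w, Biv.shear l₂ u₂ x ∈ annih b w := by
    by_cases ha0 : a = 0
    · refine ⟨0, 0, dot_zero_left _, ?_, fun x hx => by rwa [shear_zero_left]⟩
      simp only [shear_zero_left]
      rw [ha0, h0] at ha
      simpa using ha
    obtain ⟨c, hc⟩ : ∃ c, k' c = k a := by
      have : k a ∈ Set.range k' := by rw [ha]; exact ⟨0, by simp only [h0, zero_add]⟩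
      exact this
    have hc0 : c ≠ 0 := by
      rintro rfl
      exact ha0 (hk.injective (by rw [← hc, h0', h0]))
    have hpc : pf (k' c) = 1 := by
      have := hk' c 0 hc0
      rwa [h0', add_zero] at this
    have hrange : ∀ l, l ≠ 0 → Set.range (fun i => Biv.shear l (act (k' c) l) (k' i)) =
        Set.range k := by
      intro l hl
      rw [hk'.range_shear h0' hc0 hl, hc]
      ext x
      constructor
      · rintro ⟨i, rfl⟩
        have : k' i ∈ Set.range fun i => k i + k a := by rw [← ha]; exact ⟨i, rfl⟩
        obtain ⟨j, hj⟩ := this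
        refine ⟨j, ?_⟩
        simp only at hj
        simp only [← hj, add_add_cancel]
      · rintro ⟨i, rfl⟩
        have : k i + k a ∈ Set.range k' := by rw [ha]; exact ⟨i, rfl⟩
        obtain ⟨j, hj⟩ := this
        exact ⟨j, by simp only [hj, add_add_cancel]⟩
    cases b
    · refine ⟨w, act (k' c) w, dot_act_self _ _, hrange w hw, fun x hx => ?_⟩
      have := shear_mem_annih_false (dot_act_self (k' c) w) hx
      rwa [dot_act_self, zero_smul, add_zero] at this
    -- This l makes w the direction of the shear, so w itself is fixed.
    · set l := act (star (k' c)) w with hl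
      have hlw : act (k' c) l = w := by
        have := act_star_act (star (k' c)) w
        rwa [star_star, pf_star, hpc, one_smul] at this
      have hl0 : l ≠ 0 := act_ne_zero (by rw [pf_star, hpc]) hw
      have hd : dot l w = 0 := by rw [dot_comm]; exact dot_act_self _ _
      refine ⟨l, act (k' c) l, dot_act_self _ _, hrange l hl0, fun x hx => ?_⟩
      have := shear_mem_annih_true (l := l) (u := act (k' c) l) hw hx
      rwa [hd, zero_smul, add_zero] at this
  refine ⟨l₁, u₁, l₂, u₂, h₁, h₂, hr, ?_⟩
  have hinj : Function.Injective fun x => Biv.shear l₂ u₂ (Biv.shear l₁ u₁ x) :=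
    (shear_injective h₂).comp (shear_injective h₁)
  apply Set.eq_of_subset_of_ncard_le
  · rintro _ ⟨x, hx, rfl⟩
    exact hmap₂ _ (hmap₁ x hx)
  · rw [Set.ncard_image_of_injective _ hinj, ncard_annih b hv, ncard_annih b hw]
  · exact Set.toFinite _

end Biv

open Biv

/-! ### Affine functions and quadratic forms on four-dimensional space -/

/-- The products of two coordinates of a vector. -/
def quad (v : Vec) : Biv := ![v 0 * v 1, v 0 * v 2, v 0 * v 3, v 1 * v 2, v 1 * v 3, v 2 * v 3]

/-- The quadratic form with a given coefficient bivector, evaluated at a vector. -/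
def quadForm (q : Biv) (v : Vec) : ZMod 2 :=
  q 5 * (v 0 * v 1) + q 4 * (v 0 * v 2) + q 3 * (v 0 * v 3) + q 2 * (v 1 * v 2) +
    q 1 * (v 1 * v 3) + q 0 * (v 2 * v 3)

theorem sum_vec {M : Type*} [AddCommMonoid M] (f : Vec → M) : ∑ v, f v =
    f ![0, 0, 0, 0] + f ![0, 0, 0, 1] + f ![0, 0, 1, 0] + f ![0, 0, 1, 1] +
    f ![0, 1, 0, 0] + f ![0, 1, 0, 1] + f ![0, 1, 1, 0] + f ![0, 1, 1, 1] +
    f ![1, 0, 0, 0] + f ![1, 0, 0, 1] + f ![1, 0, 1, 0] + f ![1, 0, 1, 1] +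
    f ![1, 1, 0, 0] + f ![1, 1, 0, 1] + f ![1, 1, 1, 0] + f ![1, 1, 1, 1] := by
  let L : List Vec := [![0, 0, 0, 0], ![0, 0, 0, 1], ![0, 0, 1, 0], ![0, 0, 1, 1],
    ![0, 1, 0, 0], ![0, 1, 0, 1], ![0, 1, 1, 0], ![0, 1, 1, 1],
    ![1, 0, 0, 0], ![1, 0, 0, 1], ![1, 0, 1, 0], ![1, 0, 1, 1],
    ![1, 1, 0, 0], ![1, 1, 0, 1], ![1, 1, 1, 0], ![1, 1, 1, 1]]
  have hL : L.Nodup := by decide +kernel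
  have hu : (Finset.univ : Finset Vec) = L.toFinset := by decide +kernel
  rw [hu, List.sum_toFinset f hL]
  simp [L, add_assoc]

theorem vec_cases (v : Vec) : v = ![v 0, v 1, v 2, v 3] := by
  ext i; fin_cases i <;> rfl

/-- Reed–Muller duality: the dual of the code of polynomials of degree at most two consists of the
affine functions. -/
theorem affine_of_orthogonal (f : Vec → ZMod 2) (h₀ : ∑ v, f v = 0) (h₁ : ∑ v, f v • v = 0)
    (h₂ : ∑ v, f v • quad v = 0) (v : Vec) :
    f v = f 0 + dot (fun i => f 0 + f (Pi.single i 1)) v := by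
  have z : (0 : Vec) = ![0, 0, 0, 0] := by decide
  have s0 : (Pi.single 0 1 : Vec) = ![1, 0, 0, 0] := by decide
  have s1 : (Pi.single 1 1 : Vec) = ![0, 1, 0, 0] := by decide
  have s2 : (Pi.single 2 1 : Vec) = ![0, 0, 1, 0] := by decide
  have s3 : (Pi.single 3 1 : Vec) = ![0, 0, 0, 1] := by decide
  simp only [dot, z, s0, s1, s2, s3]
  have a := fun i => congrFun h₁ i
  have b := fun i => congrFun h₂ i
  simp only [sum_vec, Pi.add_apply, Pi.smul_apply, Pi.zero_apply, smul_eq_mul] at h₀ a b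
  have a0 := a 0
  have a1 := a 1
  have a2 := a 2
  have a3 := a 3
  have b0 := b 0
  have b1 := b 1
  have b2 := b 2
  have b3 := b 3
  have b4 := b 4
  have b5 := b 5
  clear a b h₁ h₂
  simp [quad] at a0 a1 a2 a3 b0 b1 b2 b3 b4 b5
  rw [vec_cases v]
  generalize v 0 = v0
  generalize v 1 = v1
  generalize v 2 = v2
  generalize v 3 = v3
  have c2 : ∀ x : ZMod 2, x = 0 ∨ x = 1 := by decide
  rcases c2 v0 with rfl | rfl <;> rcases c2 v1 with rfl | rfl <;> rcases c2 v2 with rfl | rfl <;>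
    rcases c2 v3 with rfl | rfl <;> simp <;> grind

theorem sum_affine : ∀ (l : Vec) (c : ZMod 2), ∑ v, (c + dot l v) = 0 ∧
    ∑ v, (c + dot l v) • v = 0 ∧ ∑ v, (c + dot l v) • quad v = 0 := by
  decide +kernel

/-- Only the full product of the four coordinates has nonzero sum, so each quadratic monomial pairs
with the complementary one. This explains the reversed coefficients in `quadForm`, and makes
`quadWord` a section of `theta`. -/
theorem sum_quadForm : ∀ q : Biv, ∑ v, quadForm q v = 0 ∧ ∑ v, quadForm q v • v = 0 ∧
    ∑ v, quadForm q v • quad v = q := by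
  decide +kernel

/-! ### The Hamming code modulo affine words -/

section Hamming

variable (e : Fin 16 ≃ (Fin 4 → ZMod 2))

/-- The extended Hamming code with columns `(1, e i)`. -/
def hamming : Set Word := {x : Word | ∑ i, x i = 0 ∧ ∑ i, x i • e i = 0}

/-- The bivector of a word of the extended Hamming code. -/
def theta (x : Word) : Biv := ∑ i, x i • quad (e i)

/-- The word of values of an affine function. -/
def affineWord (c : ZMod 2) (l : Vec) : Word := fun i => c + dot l (e i)

/-- The word of values of a quadratic form. -/
def quadWord (q : Biv) : Word := fun i => quadForm q (e i)

variable {e}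

theorem word_add_self (x : Word) : x + x = 0 := by ext; exact CharTwo.add_self_eq_zero _

theorem word_add_add_cancel (x y : Word) : x + y + y = x := by
  rw [add_assoc, word_add_self, add_zero]

theorem word_add_add_cancel_left (x y : Word) : x + (x + y) = y := by
  rw [← add_assoc, word_add_self, zero_add]

theorem word_add_eq_zero {x y : Word} : x + y = 0 ↔ x = y := by
  constructor
  · intro h
    rw [← word_add_add_cancel x y, h, zero_add]
  · rintro rfl; exact word_add_self x

theorem zero_mem_hamming : (0 : Word) ∈ hamming e := by simp [hamming]

theorem add_mem_hamming {x y : Word} (hx : x ∈ hamming e) (hy : y ∈ hamming e) :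
    x + y ∈ hamming e := by
  obtain ⟨h1, h2⟩ := hx
  obtain ⟨h3, h4⟩ := hy
  refine ⟨?_, ?_⟩
  · simp only [Pi.add_apply, Finset.sum_add_distrib, h1, h3, add_zero]
  · simp only [Pi.add_apply, add_smul, Finset.sum_add_distrib, h2, h4, add_zero]

theorem theta_add (x y : Word) : theta e (x + y) = theta e x + theta e y := by
  simp only [theta, Pi.add_apply, add_smul, Finset.sum_add_distrib]

theorem theta_zero : theta e 0 = 0 := by simp [theta]

theorem affineWord_mem (c : ZMod 2) (l : Vec) : affineWord e c l ∈ hamming e :=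
  ⟨(Equiv.sum_comp e fun v => c + dot l v).trans (sum_affine l c).1,
    (Equiv.sum_comp e fun v => (c + dot l v) • v).trans (sum_affine l c).2.1⟩

theorem theta_affineWord (c : ZMod 2) (l : Vec) : theta e (affineWord e c l) = 0 :=
  (Equiv.sum_comp e fun v => (c + dot l v) • quad v).trans (sum_affine l c).2.2

theorem quadWord_mem (q : Biv) : quadWord e q ∈ hamming e :=
  ⟨(Equiv.sum_comp e fun v => quadForm q v).trans (sum_quadForm q).1,
    (Equiv.sum_comp e fun v => quadForm q v • v).trans (sum_quadForm q).2.1⟩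

theorem theta_quadWord (q : Biv) : theta e (quadWord e q) = q :=
  (Equiv.sum_comp e fun v => quadForm q v • quad v).trans (sum_quadForm q).2.2

theorem exists_eq_affineWord {x : Word} (hx : x ∈ hamming e) (h : theta e x = 0) :
    ∃ c l, x = affineWord e c l := by
  have key := affine_of_orthogonal (fun v => x (e.symm v)) ?_ ?_ ?_
  · refine ⟨x (e.symm 0), fun i => x (e.symm 0) + x (e.symm (Pi.single i 1)), funext fun i => ?_⟩
    have := key (e i)
    rwa [Equiv.symm_apply_apply] at this
  · rw [← Equiv.sum_comp e]; simpa using hx.1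
  · rw [← Equiv.sum_comp e]; simpa using hx.2
  · rw [← Equiv.sum_comp e]; simpa [theta] using h

theorem affineWord_inj {c d : ZMod 2} {l m : Vec} (h : affineWord e c l = affineWord e d m) :
    c = d ∧ l = m := by
  have key : ∀ v, c + dot l v = d + dot m v := fun v => by
    simpa [affineWord] using congrFun h (e.symm v)
  have h0 : c = d := by simpa [dot] using key 0
  refine ⟨h0, ?_⟩
  subst h0
  ext i
  have := key (Pi.single i 1)
  fin_cases i <;> simpa [dot] using this

/-- The words of the Hamming code with bivector in `K`. -/
def fiber (e : Fin 16 ≃ (Fin 4 → ZMod 2)) (K : Set Biv) : Set Word :=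
  {x | x ∈ hamming e ∧ theta e x ∈ K}

/-- Over each bivector lies one coset of the 2 · 16 affine words, represented by its `quadWord`. -/
theorem ncard_fiber (K : Set Biv) : (fiber e K).ncard = 32 * K.ncard := by
  let f : Biv × (ZMod 2 × Vec) → Word := fun p => quadWord e p.1 + affineWord e p.2.1 p.2.2
  have hf : fiber e K = f '' (K ×ˢ Set.univ) := by
    ext x
    constructor
    · rintro ⟨hx, hK⟩
      obtain ⟨c, l, h⟩ := exists_eq_affineWord (add_mem_hamming hx (quadWord_mem (theta e x)))
        (by rw [theta_add, theta_quadWord, add_self])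
      refine ⟨(theta e x, c, l), ⟨hK, trivial⟩, ?_⟩
      simp only [f]
      rw [← h, add_comm, word_add_add_cancel]
    · rintro ⟨⟨q, c, l⟩, ⟨hq, -⟩, rfl⟩
      refine ⟨add_mem_hamming (quadWord_mem q) (affineWord_mem c l), ?_⟩
      simp only [f, theta_add, theta_quadWord, theta_affineWord, add_zero]
      exact hq
  have hinj : Function.Injective f := by
    rintro ⟨q, c, l⟩ ⟨r, d, m⟩ h
    have h1 := congrArg (theta e) h
    simp only [f, theta_add, theta_quadWord, theta_affineWord, add_zero] at h1
    subst h1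
    obtain ⟨rfl, rfl⟩ := affineWord_inj (add_left_cancel h)
    rfl
  rw [hf, Set.ncard_image_of_injective _ hinj, Set.ncard_prod, mul_comm]
  simp [Set.ncard_univ]

theorem ncard_hamming : (hamming e).ncard = 2048 := by
  have : hamming e = fiber e Set.univ := by simp [fiber]
  rw [this, ncard_fiber]
  simp [Set.ncard_univ]

/-- The word with support in four given positions. -/
def fourWord (i j m n : Fin 16) : Word :=
  Pi.single i 1 + Pi.single j 1 + Pi.single m 1 + Pi.single n 1

theorem sum_fourWord_smul {M : Type*} [AddCommMonoid M] [Module (ZMod 2) M] (f : Fin 16 → M)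
    (i j m n : Fin 16) : ∑ a, fourWord i j m n a • f a = f i + f j + f m + f n := by
  simp [fourWord, add_smul, Finset.sum_add_distrib, Pi.single_apply, ite_smul]

theorem fourWord_mem_iff {i j m n : Fin 16} :
    fourWord i j m n ∈ hamming e ↔ e i + e j + e m + e n = 0 := by
  simp only [hamming, Set.mem_ofPred_eq, sum_fourWord_smul]
  refine and_iff_right ?_
  have := sum_fourWord_smul (fun _ => (1 : ZMod 2)) i j m n
  simp only [smul_eq_mul, mul_one] at this
  rw [this]; decide

theorem quad_add_four (a b c : Vec) :
    quad a + quad b + quad c + quad (a + b + c) = wedge (a + b) (a + c) := by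
  ext i; fin_cases i <;> simp [quad, wedge] <;> grind

/-- Membership makes the four columns sum to zero, and the linear and constant parts of the
quadratic monomials then cancel. The decomposable result is what links low weight to singularity. -/
theorem theta_fourWord {i j m n : Fin 16} (h : fourWord i j m n ∈ hamming e) :
    theta e (fourWord i j m n) = wedge (e i + e j) (e i + e m) := by
  rw [theta, sum_fourWord_smul]
  rw [fourWord_mem_iff] at h
  have : e n = e i + e j + e m := by
    ext a
    have := congrFun h a
    simp only [Pi.add_apply, Pi.zero_apply] at this ⊢
    grind
  rw [this, quad_add_four]

theorem hammingDist_add_single (x : Word) (i : Fin 16) :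
    hammingDist x (x + Pi.single i 1) ≤ 1 := by
  rw [hammingDist, Finset.card_le_one]
  intro a ha b hb
  have : ∀ a, x a ≠ (x + Pi.single i 1 : Word) a → a = i := by
    intro a ha
    by_contra h
    simp [h] at ha
  rw [this a (by simpa using ha), this b (by simpa using hb)]

theorem hammingDist_add_fourWord (x : Word) (i j m n : Fin 16) :
    hammingDist x (x + fourWord i j m n) ≤ 4 := by
  simp only [fourWord, ← add_assoc]
  have h1 := hammingDist_add_single x i
  have h2 := hammingDist_add_single (x + Pi.single i 1) j
  have h3 := hammingDist_add_single (x + Pi.single i 1 + Pi.single j 1) m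
  have h4 := hammingDist_add_single (x + Pi.single i 1 + Pi.single j 1 + Pi.single m 1) n
  have t1 := hammingDist_triangle x (x + Pi.single i 1)
    (x + Pi.single i 1 + Pi.single j 1)
  have t2 := hammingDist_triangle x (x + Pi.single i 1 + Pi.single j 1)
    (x + Pi.single i 1 + Pi.single j 1 + Pi.single m 1)
  have t3 := hammingDist_triangle x (x + Pi.single i 1 + Pi.single j 1 + Pi.single m 1)
    (x + Pi.single i 1 + Pi.single j 1 + Pi.single m 1 + Pi.single n 1)
  omega

/-- A nonzero singular bivector is the bivector of a word of weight four. -/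
theorem exists_fourWord {w : Vec} (hw : w ≠ 0) {x : Biv} (hx : x ∈ annih true w)
    (i j : Fin 16) (hij : e i + e j = w) :
    ∃ m n, fourWord i j m n ∈ hamming e ∧ theta e (fourWord i j m n) = x := by
  obtain ⟨z, rfl⟩ := exists_wedge_of_act_star w hw x hx
  have h : fourWord i j (e.symm (e i + z)) (e.symm (e j + z)) ∈ hamming e := by
    rw [fourWord_mem_iff, Equiv.apply_symm_apply, Equiv.apply_symm_apply]
    ext a
    simp only [Pi.add_apply, Pi.zero_apply]
    grind
  refine ⟨_, _, h, ?_⟩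
  rw [theta_fourWord h, hij, Equiv.apply_symm_apply, vec_add_add]

theorem exists_annih_of_pf : ∀ x : Biv, pf x = 0 → ∃ w : Vec, w ≠ 0 ∧ act (star x) w = 0 := by
  decide +kernel

theorem codeTranslate_fiber {y : Word} (hy : y ∈ hamming e) (K : Set Biv) :
    codeTranslate y (fiber e K) = fiber e ((fun x => x + theta e y) '' K) := by
  ext x
  constructor
  · rintro ⟨z, ⟨hz, hK⟩, rfl⟩
    exact ⟨add_mem_hamming hy hz, _, hK, by simp only [theta_add, add_comm]⟩
  · rintro ⟨hx, q, hq, h⟩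
    refine ⟨y + x, ⟨add_mem_hamming hy hx, ?_⟩, word_add_add_cancel_left y x⟩
    rw [theta_add, ← h, add_comm, add_add_cancel]
    exact hq

end Hamming

/-! ### Bent functions and characters of the word space -/

/-- The sign character of `ZMod 2`. -/
def sgn (a : ZMod 2) : ℤ := if a = 0 then 1 else -1

theorem sgn_add : ∀ a b : ZMod 2, sgn (a + b) = sgn a * sgn b := by decide

theorem sgn_mul_self : ∀ a : ZMod 2, sgn a * sgn a = 1 := by decide

theorem vec_add_eq_zero {v w : Vec} : v + w = 0 ↔ v = w := by
  constructor
  · intro h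
    have : w + w = 0 := by ext; exact CharTwo.add_self_eq_zero _
    exact add_right_cancel (h.trans this.symm)
  · rintro rfl; ext; exact CharTwo.add_self_eq_zero _

/-- The Walsh coefficients of a function with vanishing autocorrelations. -/
theorem walsh_sq (f : Vec → ZMod 2)
    (hf : ∀ w, w ≠ 0 → ∑ v, sgn (f v) * sgn (f (v + w)) = 0) (c : ZMod 2) (l : Vec) :
    (∑ v, sgn (c + dot l v) * sgn (f v)) ^ 2 = 16 := by
  have hadd : ∀ v w, dot l (v + w) = dot l v + dot l w := fun v w => by
    rw [dot_comm, dot_add_left, dot_comm v, dot_comm w]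
  calc (∑ v, sgn (c + dot l v) * sgn (f v)) ^ 2
      = ∑ v, ∑ w, (sgn (c + dot l v) * sgn (f v)) * (sgn (c + dot l w) * sgn (f w)) := by
        rw [sq, Finset.sum_mul_sum]
    _ = ∑ v, ∑ w, sgn (dot l w) * (sgn (f v) * sgn (f (v + w))) := by
        refine Finset.sum_congr rfl fun v _ => ?_
        rw [← Equiv.sum_comp (Equiv.addLeft v)]
        refine Finset.sum_congr rfl fun w _ => ?_
        simp only [Equiv.coe_addLeft, hadd, sgn_add]
        linear_combination sgn (dot l w) * sgn (f v) * sgn (f (v + w)) *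
          (sgn (dot l v) * sgn (dot l v) * sgn_mul_self c + sgn_mul_self (dot l v))
    _ = ∑ w, sgn (dot l w) * ∑ v, sgn (f v) * sgn (f (v + w)) := by
        rw [Finset.sum_comm]
        simp only [Finset.mul_sum]
    _ = sgn (dot l 0) * ∑ v, sgn (f v) * sgn (f (v + 0)) :=
        Finset.sum_eq_single 0 (fun w _ hw => by rw [hf w hw, mul_zero]) (by simp)
    _ = 16 := by
        simp only [add_zero, sgn_mul_self]
        simp [dot, sgn]

theorem sum_sgn_affine : ∀ (l : Vec) (c : ZMod 2), (∑ v, sgn (c + dot l v)) % 16 = 0 := by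
  decide +kernel

/-- Let m count the common ones of f and the affine function. Then 4m = 16 - W0 - t + W, where W and
W0 are Walsh coefficients, equal to 4 or -4, and 16 divides t. So 8 divides 4m, and m is even. -/
theorem sum_mul_affine_eq_zero (f : Vec → ZMod 2)
    (hf : ∀ w, w ≠ 0 → ∑ v, sgn (f v) * sgn (f (v + w)) = 0) (c : ZMod 2) (l : Vec) :
    ∑ v, (c + dot l v) * f v = 0 := by
  have h1 := walsh_sq f hf c l
  have h0 := walsh_sq f hf 0 0
  have ht := sum_sgn_affine l c
  have hz : ∀ v, sgn (0 + dot 0 v) = 1 := fun v => by simp [dot_zero_left, sgn]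
  simp only [hz, one_mul] at h0
  set W := ∑ v, sgn (c + dot l v) * sgn (f v)
  set W0 := ∑ v, sgn (f v)
  set t := ∑ v, sgn (c + dot l v)
  let m : ℕ := (Finset.univ.filter fun v => (c + dot l v) * f v = 1).card
  have hm : ∑ v, (c + dot l v) * f v = (m : ZMod 2) := by
    rw [show m = _ from Finset.card_filter _ _, Nat.cast_sum]
    refine Finset.sum_congr rfl fun v _ => ?_
    exact (by decide : ∀ a : ZMod 2, a = ((if a = 1 then 1 else 0 : ℕ) : ZMod 2)) _
  have h4 : 4 * (m : ℤ) = 16 - W0 - t + W := by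
    have e1 : ∀ a b : ZMod 2, 4 * (if a * b = 1 then 1 else 0 : ℤ) =
        1 - sgn b - sgn a + sgn a * sgn b := by decide
    have : (m : ℤ) = ∑ v, (if (c + dot l v) * f v = 1 then 1 else 0 : ℤ) := by
      simp [m]
    rw [this, Finset.mul_sum, Finset.sum_congr rfl fun v _ => e1 (c + dot l v) (f v)]
    simp only [Finset.sum_add_distrib, Finset.sum_sub_distrib]
    simp [W, W0, t]
  have hW : W = 4 ∨ W = -4 := by
    have : (W - 4) * (W + 4) = 0 := by linear_combination h1
    rcases mul_eq_zero.mp this with h | h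
    · left; linarith
    · right; linarith
  have hW0 : W0 = 4 ∨ W0 = -4 := by
    have : (W0 - 4) * (W0 + 4) = 0 := by linear_combination h0
    rcases mul_eq_zero.mp this with h | h
    · left; linarith
    · right; linarith
  rw [hm]
  have : 2 ∣ m := by omega
  exact (ZMod.natCast_eq_zero_iff _ _).mpr this

/-- The additive characters of the space of words. -/
def chi (u x : Word) : ℤ := sgn (∑ i, x i * u i)

theorem chi_add (u x y : Word) : chi u (x + y) = chi u x * chi u y := by
  rw [chi, chi, chi, ← sgn_add, ← Finset.sum_add_distrib]
  simp only [Pi.add_apply, add_mul]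

theorem chi_add_left (u v x : Word) : chi (u + v) x = chi u x * chi v x := by
  rw [chi, chi, chi, ← sgn_add, ← Finset.sum_add_distrib]
  simp only [Pi.add_apply, mul_add]

theorem exists_chi_eq_neg_one {x : Word} (hx : x ≠ 0) : ∃ u, chi u x = -1 := by
  obtain ⟨i, hi⟩ : ∃ i, x i ≠ 0 := by
    by_contra! h
    exact hx (funext h)
  refine ⟨Pi.single i 1, ?_⟩
  simp [chi, Pi.single_apply, sgn, hi]

theorem sum_chi_add (x v : Word) : ∑ u, chi (u + v) x = ∑ u, chi u x :=
  Equiv.sum_comp (Equiv.addRight v) fun u => chi u x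

theorem eq_zero_of_mul_neg_one {a : ℤ} (h : a * (-1) = a) : a = 0 := by omega

theorem sum_chi_eq_zero {x : Word} (hx : x ≠ 0) : ∑ u, chi u x = 0 := by
  obtain ⟨v, h1⟩ := exists_chi_eq_neg_one hx
  have h2 := sum_chi_add x v
  simp only [chi_add_left, h1] at h2
  rw [← Finset.sum_mul] at h2
  exact eq_zero_of_mul_neg_one h2

theorem sum_chi_zero : ∑ u : Word, chi u 0 = 65536 := by
  simp [chi, sgn]

/-- A set of words is invariant under every word that is orthogonal to its spectrum. -/
theorem add_mem_of_chi (N : Finset Word) (r : Word)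
    (h : ∀ u, ∑ x ∈ N, chi u x ≠ 0 → chi u r = 1) {x : Word} (hx : x ∈ N) : x + r ∈ N := by
  -- Fourier inversion for the indicator function of N, with 65536 = 2^16.
  have key : ∀ z, ∑ u, (∑ y ∈ N, chi u y) * chi u z = if z ∈ N then 65536 else 0 := by
    intro z
    simp only [Finset.sum_mul]
    rw [Finset.sum_comm]
    have : ∀ y ∈ N, ∑ u, chi u y * chi u z = if y = z then 65536 else 0 := by
      intro y _
      simp only [← chi_add]
      split_ifs with hyz
      · rw [hyz, word_add_self, sum_chi_zero]
      · exact sum_chi_eq_zero fun h => hyz (word_add_eq_zero.mp h)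
    rw [Finset.sum_congr rfl this, Finset.sum_ite_eq']
  have h1 := key x
  have h2 := key (x + r)
  rw [if_pos hx] at h1
  by_contra hr
  rw [if_neg hr] at h2
  have : ∀ u, (∑ y ∈ N, chi u y) * chi u (x + r) = (∑ y ∈ N, chi u y) * chi u x := by
    intro u
    by_cases hu : ∑ y ∈ N, chi u y = 0
    · rw [hu, zero_mul, zero_mul]
    · rw [chi_add, h u hu, mul_one]
  rw [Finset.sum_congr rfl fun u _ => this u, h1] at h2
  norm_num at h2

/-! ### Invariance of Nordstrom–Robinson codes under affine words -/

section Spectrum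

variable {e : Fin 16 ≃ (Fin 4 → ZMod 2)}

theorem fourWord_partner_mem (i j c : Fin 16) :
    fourWord i j c (e.symm (e c + (e i + e j))) ∈ hamming e := by
  rw [fourWord_mem_iff, Equiv.apply_symm_apply]
  ext a
  simp only [Pi.add_apply, Pi.zero_apply]
  grind

/-- Distances six inside the Hamming code force every word to be covered twice by the words
`fourWord i j c c'` with `c' = e⁻¹ (e c + e i + e j)`. -/
theorem card_filter_fourWord_eq_two {N : Finset Word} (hN : ↑N ⊆ hamming e)
    (hcard : N.card = 256) (hd : ∀ x ∈ N, ∀ y ∈ N, x ≠ y → 6 ≤ hammingDist x y)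
    {i j : Fin 16} (hij : i ≠ j) {z : Word} (hz : z ∈ hamming e) :
    (Finset.univ.filter fun c =>
      z + fourWord i j c (e.symm (e c + (e i + e j))) ∈ N).card = 2 := by
  classical
  set p : Fin 16 → Fin 16 := fun c => e.symm (e c + (e i + e j)) with hp
  have hmem : ∀ c, fourWord i j c (p c) ∈ hamming e :=
    fun c => fourWord_partner_mem i j c
  let H : Finset Word := (Set.toFinite (hamming e)).toFinset
  have hH : ∀ x, x ∈ H ↔ x ∈ hamming e := by simp [H]
  have hHcard : H.card = 2048 := by
    rw [← ncard_hamming (e := e), Set.ncard_eq_toFinset_card _ (Set.toFinite _)]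
  -- Two such words of N differ by a word of weight at most four, hence coincide; this leaves only c
  -- and its partner `p c`.
  have hle : ∀ z, (Finset.univ.filter fun c => z + fourWord i j c (p c) ∈ N).card ≤ 2 := by
    intro z
    by_cases hne : (Finset.univ.filter fun c => z + fourWord i j c (p c) ∈ N).Nonempty
    · obtain ⟨c, hc⟩ := hne
      have hsub : (Finset.univ.filter fun c => z + fourWord i j c (p c) ∈ N) ⊆ {c, p c} := by
        intro d hd'
        simp only [Finset.mem_filter, Finset.mem_univ, true_and] at hc hd'
        have hsum : z + fourWord i j d (p d) =
            z + fourWord i j c (p c) + fourWord c (p c) d (p d) := by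
          ext a
          simp only [fourWord, Pi.add_apply]
          grind
        have heq : z + fourWord i j c (p c) = z + fourWord i j d (p d) := by
          by_contra hne
          have h1 := hd _ hc _ hd' hne
          rw [hsum] at h1
          have h2 := hammingDist_add_fourWord (z + fourWord i j c (p c)) c (p c) d (p d)
          omega
        have h0 := congrFun (add_left_cancel heq) d
        by_contra hnot
        simp only [Finset.mem_insert, Finset.mem_singleton, not_or] at hnot
        simp only [fourWord, Pi.add_apply, Pi.single_apply, if_neg hnot.1, if_neg hnot.2,
          if_true, add_zero] at h0
        by_cases hdp : d = p d
        · have := congrArg e hdp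
          simp only [hp, Equiv.apply_symm_apply, left_eq_add] at this
          exact hij (e.injective (vec_add_eq_zero.mp this))
        · rw [if_neg hdp, add_zero] at h0
          simp at h0
      exact (Finset.card_le_card hsub).trans Finset.card_le_two
    · rw [Finset.not_nonempty_iff_eq_empty.mp hne]; simp
  -- Double counting: 16 · 256 = 2 · 2048, so the upper bound two is attained everywhere.
  have hsum : ∑ z ∈ H, (Finset.univ.filter fun c => z + fourWord i j c (p c) ∈ N).card =
      ∑ z ∈ H, 2 := by
    simp only [Finset.card_filter]
    rw [Finset.sum_comm]
    have : ∀ c, (∑ z ∈ H, if z + fourWord i j c (p c) ∈ N then 1 else 0) = 256 := by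
      intro c
      rw [← Finset.card_filter, ← hcard]
      refine Finset.card_bij (fun z _ => z + fourWord i j c (p c)) ?_ ?_ ?_
      · intro z hz; exact (Finset.mem_filter.mp hz).2
      · intro a _ b _ h; exact add_right_cancel h
      · intro x hx
        refine ⟨x + fourWord i j c (p c), Finset.mem_filter.mpr ⟨?_, ?_⟩,
          word_add_add_cancel _ _⟩
        · rw [hH]; exact add_mem_hamming (hN hx) (hmem c)
        · rwa [word_add_add_cancel]
    rw [Finset.sum_congr rfl fun c _ => this c]
    simp [hHcard]
  exact (Finset.sum_eq_sum_iff_of_le fun z _ => hle z).mp hsum z ((hH z).mpr hz)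

/-- Apply the character u to the double covering. Its sum over the Hamming code vanishes, so the
product of its sums over N and over the sixteen covering words is zero. The first factor is nonzero,
and the second is the autocorrelation at w up to sign. -/
theorem autocorrelation_eq_zero {N : Finset Word} (hN : ↑N ⊆ hamming e)
    (hcard : N.card = 256) (hd : ∀ x ∈ N, ∀ y ∈ N, x ≠ y → 6 ≤ hammingDist x y)
    {u : Word} (hu : ∑ x ∈ N, chi u x ≠ 0) {y : Word} (hy : y ∈ hamming e)
    (hyu : chi u y ≠ 1) (w : Vec) (hw : w ≠ 0) :
    ∑ v, sgn (u (e.symm v)) * sgn (u (e.symm (v + w))) = 0 := by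
  classical
  set i := e.symm 0 with hi
  set j := e.symm w with hj
  have hij : i ≠ j := fun h => hw (e.symm.injective h).symm
  have hsum : e i + e j = w := by simp [hi, hj]
  let H : Finset Word := (Set.toFinite (hamming e)).toFinset
  have hH : ∀ x, x ∈ H ↔ x ∈ hamming e := by simp [H]
  set d : Fin 16 → Word := fun c => fourWord i j c (e.symm (e c + (e i + e j))) with hdd
  have hmem : ∀ c, d c ∈ hamming e :=
    fun c => fourWord_partner_mem i j c
  have hyu' : chi u y = -1 := by
    unfold chi sgn at *
    split_ifs at * <;> simp_all
  have hH0 : ∑ z ∈ H, chi u z = 0 := by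
    have : ∑ z ∈ H, chi u (z + y) = ∑ z ∈ H, chi u z := by
      refine Finset.sum_bij (fun z _ => z + y) ?_ ?_ ?_ ?_
      · intro z hz; rw [hH] at *; exact add_mem_hamming hz hy
      · intro a _ b _ h; exact add_right_cancel h
      · intro z hz
        exact ⟨z + y, by rw [hH] at *; exact add_mem_hamming hz hy, word_add_add_cancel _ _⟩
      · intro _ _; rfl
    simp only [chi_add, hyu', ← Finset.sum_mul] at this
    exact eq_zero_of_mul_neg_one this
  have key : (∑ x ∈ N, chi u x) * ∑ c, chi u (d c) = 0 := by
    have h1 : ∀ c, ∑ z ∈ H, (if z + d c ∈ N then chi u z else 0) =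
        (∑ x ∈ N, chi u x) * chi u (d c) := by
      intro c
      rw [← Finset.sum_filter, Finset.sum_mul]
      refine Finset.sum_bij (fun z _ => z + d c) ?_ ?_ ?_ ?_
      · intro z hz; exact (Finset.mem_filter.mp hz).2
      · intro a _ b _ h; exact add_right_cancel h
      · intro x hx
        refine ⟨x + d c, Finset.mem_filter.mpr ⟨?_, ?_⟩, word_add_add_cancel _ _⟩
        · rw [hH]; exact add_mem_hamming (hN hx) (hmem c)
        · rwa [word_add_add_cancel]
      · intro z _
        rw [← chi_add, word_add_add_cancel]
    rw [Finset.mul_sum, ← Finset.sum_congr rfl fun c _ => h1 c, Finset.sum_comm]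
    have h2 : ∀ z ∈ H, ∑ c, (if z + d c ∈ N then chi u z else 0) = 2 * chi u z := by
      intro z hz
      rw [← Finset.sum_filter, Finset.sum_const,
        card_filter_fourWord_eq_two hN hcard hd hij ((hH z).mp hz)]
      simp
    rw [Finset.sum_congr rfl h2, ← Finset.mul_sum, hH0, mul_zero]
  have h3 := (mul_eq_zero.mp key).resolve_left hu
  have h4 : ∀ c, chi u (d c) = sgn (u i) * sgn (u j) *
      (sgn (u (e.symm (e c))) * sgn (u (e.symm (e c + w)))) := by
    intro c
    have := sum_fourWord_smul (fun a => u a) i j c (e.symm (e c + (e i + e j)))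
    simp only [smul_eq_mul] at this
    rw [chi, hdd, this, hsum, sgn_add, sgn_add, sgn_add, Equiv.symm_apply_apply]
    ring
  rw [Finset.sum_congr rfl fun c _ => h4 c, ← Finset.mul_sum,
    Equiv.sum_comp e fun v => sgn (u (e.symm v)) * sgn (u (e.symm (v + w)))] at h3
  refine (mul_eq_zero.mp h3).resolve_left ?_
  have hs : ∀ a : ZMod 2, sgn a ≠ 0 := by decide
  exact mul_ne_zero (hs _) (hs _)

/-- A code in the Hamming code with 256 words and distances at least six is invariant under
the affine words. -/
theorem add_affineWord_mem {N : Finset Word} (hN : ↑N ⊆ hamming e)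
    (hcard : N.card = 256) (hd : ∀ x ∈ N, ∀ y ∈ N, x ≠ y → 6 ≤ hammingDist x y)
    (c : ZMod 2) (l : Vec) {x : Word} (hx : x ∈ N) : x + affineWord e c l ∈ N := by
  refine add_mem_of_chi N _ (fun u hu => ?_) hx
  by_contra hne
  -- A spectral character nontrivial on an affine word would be bent, hence orthogonal to that very
  -- word.
  have hz := sum_mul_affine_eq_zero (fun v => u (e.symm v))
    (autocorrelation_eq_zero hN hcard hd hu (affineWord_mem c l) hne) c l
  rw [← Equiv.sum_comp e] at hz
  simp only [Equiv.symm_apply_apply] at hz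
  apply hne
  have : ∑ i, affineWord e c l i * u i = 0 := hz
  rw [chi, this]; rfl

end Spectrum

/-! ### Nordstrom–Robinson codes as translates of a clique; partitions as Fano planes -/

section Cells

variable {e : Fin 16 ≃ (Fin 4 → ZMod 2)} {k : Fin 8 → Biv}

theorem fiber_subset_fiber {K K' : Set Biv} (h : fiber e K ⊆ fiber e K') : K ⊆ K' := by
  intro q hq
  have : quadWord e q ∈ fiber e K := ⟨quadWord_mem q, by rwa [theta_quadWord]⟩
  have := (h this).2
  rwa [theta_quadWord] at this

theorem fiber_injective : Function.Injective (fiber e) := fun _ _ h =>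
  Set.Subset.antisymm (fiber_subset_fiber h.le) (fiber_subset_fiber h.ge)

theorem eq_one_of_ne_zero : ∀ a : ZMod 2, a ≠ 0 → a = 1 := by decide

/-- Every Nordstrom–Robinson code inside the Hamming code comes from a clique. -/
theorem IsNordstromRobinson.exists_clique {N : Set Word} (hN : IsNordstromRobinson N)
    (hsub : N ⊆ hamming e) : ∃ k, IsClique k ∧ N = fiber e (Set.range k) := by
  obtain ⟨hcard, hleast⟩ := hN
  have hd : ∀ x ∈ N, ∀ y ∈ N, x ≠ y → 6 ≤ hammingDist x y := fun x hx y hy hxy =>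
    hleast.2 ⟨x, hx, y, hy, hxy, rfl⟩
  have haff : ∀ c l, ∀ x ∈ N, x + affineWord e c l ∈ N := by
    intro c l x hx
    let N' : Finset Word := (Set.toFinite N).toFinset
    have hN' : ∀ x, x ∈ N' ↔ x ∈ N := by simp [N']
    rw [← hN']
    refine add_affineWord_mem (N := N') ?_ ?_ ?_ c l ((hN' x).mpr hx)
    · intro y hy; exact hsub ((hN' y).mp hy)
    · rw [← hcard, Set.ncard_eq_toFinset_card _ (Set.toFinite _)]
    · intro a ha b hb; exact hd a ((hN' a).mp ha) b ((hN' b).mp hb)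
  set K := theta e '' N with hK
  have hfib : ∀ x ∈ hamming e, theta e x ∈ K → x ∈ N := by
    rintro x hx ⟨y, hy, hyx⟩
    obtain ⟨c, l, h⟩ := exists_eq_affineWord (add_mem_hamming (hsub hy) hx)
      (by rw [theta_add, hyx, add_self])
    rw [← word_add_add_cancel_left y x, h]
    exact haff c l y hy
  have hNK : N = fiber e K :=
    Set.Subset.antisymm (fun x hx => ⟨hsub hx, x, hx, rfl⟩) fun x hx => hfib x hx.1 hx.2
  have hK8 : K.ncard = 8 := by
    have := ncard_fiber (e := e) K
    rw [← hNK, hcard] at this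
    omega
  -- A singular sum would be the bivector of some `fourWord`, and translating a word of N by it
  -- would give another word of N at distance at most four.
  have hpf : ∀ p ∈ K, ∀ q ∈ K, p ≠ q → pf (p + q) = 1 := by
    rintro _ ⟨a, ha, rfl⟩ _ ⟨b, hb, rfl⟩ hab
    apply eq_one_of_ne_zero
    intro h0
    obtain ⟨w, hw, hann⟩ := exists_annih_of_pf _ h0
    obtain ⟨m, n, hm, ht⟩ := exists_fourWord (e := e) hw hann (e.symm 0) (e.symm w) (by simp)
    set y := fourWord (e.symm 0) (e.symm w) m n with hy
    have hby : b + y ∈ N := by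
      refine hfib _ (add_mem_hamming (hsub hb) hm) ⟨a, ha, ?_⟩
      rw [theta_add, ht, add_comm (theta e a), ← add_assoc, add_self, zero_add]
    have hne : b ≠ b + y := by
      intro h
      rw [left_eq_add] at h
      rw [h, theta_zero] at ht
      exact hab (add_eq_zero_iff.mp ht.symm)
    have h1 := hd b hb _ hby hne
    have h2 := hammingDist_add_fourWord b (e.symm 0) (e.symm w) m n
    rw [← hy] at h2
    omega
  let Kf : Finset Biv := (Set.toFinite K).toFinset
  have hKf : Kf.card = 8 := by rw [← hK8, Set.ncard_eq_toFinset_card _ (Set.toFinite _)]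
  have hmem : ∀ x, x ∈ Kf ↔ x ∈ K := by simp [Kf]
  let E := Kf.equivFinOfCardEq hKf
  have hrange : Set.range (fun i => (E.symm i : Biv)) = K := by
    ext x
    constructor
    · rintro ⟨i, rfl⟩; exact (hmem _).mp (E.symm i).2
    · intro hx; exact ⟨E ⟨x, (hmem x).mpr hx⟩, by simp⟩
  refine ⟨fun i => (E.symm i : Biv), fun i j hij => ?_, by rw [hrange, ← hNK]⟩
  refine hpf _ ((hmem _).mp (E.symm i).2) _ ((hmem _).mp (E.symm j).2) fun h => hij ?_
  exact E.symm.injective (Subtype.ext h)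

/-- The code belonging to the translate of a clique by a bivector. -/
def cell (e : Fin 16 ≃ (Fin 4 → ZMod 2)) (k : Fin 8 → Biv) (x : Biv) : Set Word :=
  fiber e (Set.range fun i => k i + x)

theorem cell_zero : cell e k 0 = fiber e (Set.range k) := by simp [cell]

theorem codeTranslate_cell {y : Word} (hy : y ∈ hamming e) (x : Biv) :
    codeTranslate y (cell e k x) = cell e k (x + theta e y) := by
  have : (fun z => z + theta e y) ∘ (fun i => k i + x) = fun i => k i + (x + theta e y) :=
    funext fun i => add_assoc _ _ _
  rw [cell, codeTranslate_fiber hy, cell, ← Set.range_comp, this]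

theorem Biv.IsClique.cell_injective (hk : IsClique k) : Function.Injective (cell e k) := by
  intro x y h
  have hr : Set.range (fun i => k i + x) = Set.range fun i => k i + y := fiber_injective h
  rw [← add_eq_zero_iff]
  refine hk.eq_zero_of_translate fun i => ?_
  have : k i + x ∈ Set.range fun i => k i + y := by rw [← hr]; exact ⟨i, rfl⟩
  obtain ⟨j, hj⟩ := this
  refine ⟨j, ?_⟩
  simp only at hj
  rw [← add_assoc, ← hj, add_add_cancel]

/-- The cells meet exactly when x + y is a sum of two clique members. For x ≠ y this means
nonsingular, because `IsClique.exists_pair` produces every nonsingular bivector. -/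
theorem Biv.IsClique.disjoint_cell_iff (hk : IsClique k) {x y : Biv} (hxy : x ≠ y) :
    Disjoint (cell e k x) (cell e k y) ↔ pf (x + y) = 0 := by
  rw [Set.disjoint_left]
  constructor
  · intro h
    by_contra hne
    obtain ⟨i, j, -, hij⟩ := hk.exists_pair (eq_one_of_ne_zero _ hne)
    refine h (a := quadWord e (k i + x)) ⟨quadWord_mem _, i, ?_⟩ ⟨quadWord_mem _, j, ?_⟩
    · rw [theta_quadWord]
    · rw [theta_quadWord]
      simp only
      have : y = x + (x + y) := by rw [← add_assoc, add_self, zero_add]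
      rw [this, hij]
      linear_combination add_self (k j)
  · rintro h z ⟨-, i, hi⟩ ⟨-, j, hj⟩
    simp only at hi hj
    have hs : k i + k j = x + y := by
      have : k i + x + (k j + y) = 0 := by rw [hi, hj, add_self]
      rw [← add_eq_zero_iff, ← this]; abel
    by_cases hij : i = j
    · rw [hij, add_self, eq_comm, add_eq_zero_iff] at hs
      exact hxy hs
    · have := hk i j hij
      rw [hs, h] at this
      exact zero_ne_one this

theorem IsNordstromRobinson.codeTranslate {N : Set Word} (hN : IsNordstromRobinson N)
    (y : Word) : IsNordstromRobinson (codeTranslate y N) := by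
  have hd : ∀ a b : Word, hammingDist (y + a) (y + b) = hammingDist a b := by
    intro a b
    simp [hammingDist]
  refine ⟨?_, ?_, ?_⟩
  · rw [_root_.codeTranslate, Set.ncard_image_of_injective _ (add_right_injective y), hN.1]
  · obtain ⟨a, ha, b, hb, hab, h⟩ := hN.2.1
    exact ⟨_, ⟨a, ha, rfl⟩, _, ⟨b, hb, rfl⟩, fun h => hab (add_left_cancel h), by rw [hd, h]⟩
  · rintro _ ⟨_, ⟨a, ha, rfl⟩, _, ⟨b, hb, rfl⟩, hab, rfl⟩
    simp only [hd]
    exact hN.2.2 ⟨a, ha, b, hb, fun h => hab (by rw [h]), rfl⟩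

theorem isNordstromRobinson_cell (hN : IsNordstromRobinson (cell e k 0)) (x : Biv) :
    IsNordstromRobinson (cell e k x) := by
  have := hN.codeTranslate (quadWord e x)
  rwa [codeTranslate_cell (quadWord_mem x), theta_quadWord, zero_add] at this

theorem Biv.IsClique.exists_eq_cell (hk : IsClique k) {C : Set Word}
    (hC : IsNordstromRobinson C) (hsub : C ⊆ hamming e) : ∃ m, C = cell e k m := by
  obtain ⟨k', hk', rfl⟩ := hC.exists_clique hsub
  obtain ⟨m, hm⟩ := hk.range_eq_translate hk'
  exact ⟨m, by rw [hm, cell]⟩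

/-- The bivectors of the members of a family of codes. -/
def cellIndices (e : Fin 16 ≃ (Fin 4 → ZMod 2)) (k : Fin 8 → Biv) (P : Set (Set Word)) :
    Set Biv := {x | cell e k x ∈ P}

theorem IsNRPartition.subset_hamming {P : Set (Set Word)} (hP : IsNRPartition (hamming e) P)
    {C : Set Word} (hC : C ∈ P) : C ⊆ hamming e := by
  rw [← hP.2.2]; exact Set.subset_sUnion_of_mem hC

theorem Biv.IsClique.image_cellIndices (hk : IsClique k) {P : Set (Set Word)}
    (hP : IsNRPartition (hamming e) P) : cell e k '' cellIndices e k P = P := by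
  ext C
  constructor
  · rintro ⟨x, hx, rfl⟩; exact hx
  · intro hC
    obtain ⟨m, rfl⟩ := hk.exists_eq_cell (hP.1 C hC) (hP.subset_hamming hC)
    exact ⟨m, hC, rfl⟩

theorem Biv.IsClique.pf_add_of_mem_cellIndices (hk : IsClique k) {P : Set (Set Word)}
    (hP : IsNRPartition (hamming e) P) {x y : Biv} (hx : x ∈ cellIndices e k P)
    (hy : y ∈ cellIndices e k P) : pf (x + y) = 0 := by
  by_cases hxy : x = y
  · rw [hxy, add_self, pf_zero]
  · rw [← hk.disjoint_cell_iff (e := e) hxy]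
    exact hP.2.1 hx hy fun h => hxy (hk.cell_injective h)

theorem Biv.IsClique.exists_mem_cellIndices (hk : IsClique k) {P : Set (Set Word)}
    (hP : IsNRPartition (hamming e) P) (z : Biv) :
    ∃ i, ∃ x ∈ cellIndices e k P, z = k i + x := by
  have : quadWord e z ∈ ⋃₀ P := by rw [hP.2.2]; exact quadWord_mem z
  obtain ⟨C, hC, hz⟩ := this
  obtain ⟨m, rfl⟩ := hk.exists_eq_cell (hP.1 C hC) (hP.subset_hamming hC)
  obtain ⟨-, i, hi⟩ := hz
  exact ⟨i, m, hC, by rw [← theta_quadWord (e := e) z, ← hi]⟩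

/-- The partition belonging to a Fano plane. -/
theorem Biv.IsClique.isNRPartition (hk : IsClique k) (h0 : k 0 = 0)
    (hN : IsNordstromRobinson (cell e k 0)) {S : Finset (Finset (Fin 7))} (hS : IsFanoPlane S) :
    IsNRPartition (hamming e) (cell e k '' planeSet k S) := by
  refine ⟨?_, ?_, ?_⟩
  · rintro _ ⟨x, -, rfl⟩; exact isNordstromRobinson_cell hN x
  · rintro _ ⟨x, hx, rfl⟩ _ ⟨y, hy, rfl⟩ hxy
    exact (hk.disjoint_cell_iff fun h => hxy (by rw [h])).mpr
      (hk.pf_add_of_mem_planeSet h0 hS hx hy)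
  · ext y
    constructor
    · rintro ⟨_, ⟨x, -, rfl⟩, hy⟩; exact hy.1
    · intro hy
      obtain ⟨i, x, hx, h⟩ := hk.exists_add (hk.card_planeSet h0 hS)
        (fun x hx y hy => hk.pf_add_of_mem_planeSet h0 hS hx hy) (theta e y)
      exact ⟨_, ⟨x, hx, rfl⟩, hy, i, h.symm⟩

theorem Biv.IsClique.lineSum_mem_planeSet_iff (hk : IsClique k) (h0 : k 0 = 0)
    {S : Finset (Finset (Fin 7))} (hS : IsFanoPlane S) {L : Finset (Fin 7)} (hL : L.card = 3) :
    lineSum k L ∈ planeSet k S ↔ L ∈ S := by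
  simp only [planeSet, Finset.mem_insert, Finset.mem_image, hk.lineSum_ne_zero h0 hL, false_or]
  constructor
  · rintro ⟨M, hM, h⟩
    rwa [← hk.lineSum_inj h0 (hS.1 M hM).le hL.le h]
  · intro h; exact ⟨L, h, rfl⟩

/-- Fano planes correspond to the partitions that contain a given code. -/
theorem Biv.IsClique.bijOn (hk : IsClique k) (h0 : k 0 = 0)
    (hN : IsNordstromRobinson (cell e k 0)) :
    Set.BijOn (fun S => cell e k '' planeSet k S) {S | IsFanoPlane S}
      {P | IsNRPartition (hamming e) P ∧ cell e k 0 ∈ P} := by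
  refine ⟨?_, ?_, ?_⟩
  · intro S hS
    exact ⟨hk.isNRPartition h0 hN hS, 0, by simp [planeSet], rfl⟩
  · intro S hS T hT h
    have h := (Set.image_injective.mpr (hk.cell_injective (e := e))) h
    refine IsFanoPlane.eq_of_subset hS hT fun L hL => ?_
    have hL3 := hS.1 L hL
    rw [← hk.lineSum_mem_planeSet_iff h0 hS hL3] at hL
    rw [← hk.lineSum_mem_planeSet_iff h0 hT hL3, ← Finset.mem_coe, ← h]
    exact hL
  · rintro P ⟨hP, hNP⟩
    refine ⟨triplesIn k (cellIndices e k P), hk.triplesIn_isFanoPlane h0 hNP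
      (fun x hx y hy => hk.pf_add_of_mem_cellIndices hP hx hy)
      (hk.exists_mem_cellIndices hP), ?_⟩
    simp only
    have : ((planeSet k (triplesIn k (cellIndices e k P)) : Finset Biv) : Set Biv) =
        cellIndices e k P := by
      ext x
      rw [Finset.mem_coe]
      refine hk.mem_planeSet_triplesIn h0 hNP fun x hx => ?_
      have := hk.pf_add_of_mem_cellIndices hP hx (y := 0) hNP
      rwa [add_zero] at this
    rw [this, hk.image_cellIndices hP]

end Cells

/-! ### Kernels and kernel decompositions -/

section Kernel

variable {e : Fin 16 ≃ (Fin 4 → ZMod 2)} {k : Fin 8 → Biv}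

/-- A kernel word is a sum of two codewords, so it lies in the Hamming code. It then translates the
clique to itself, and a clique has trivial stabiliser, so its bivector is zero. -/
theorem Biv.IsClique.codeKer_eq (hk : IsClique k) :
    codeKer (fiber e (Set.range k)) = fiber e {0} := by
  ext y
  simp only [codeKer, ← cell_zero]
  constructor
  · intro h
    have h : codeTranslate y (cell e k 0) = cell e k 0 := h
    have hy : y ∈ hamming e := by
      have h1 : quadWord e (k 0) ∈ cell e k 0 :=
        ⟨quadWord_mem _, 0, by rw [theta_quadWord]; exact add_zero _⟩
      have h2 : y + quadWord e (k 0) ∈ cell e k 0 := by rw [← h]; exact ⟨_, h1, rfl⟩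
      rw [← word_add_add_cancel y (quadWord e (k 0))]
      exact add_mem_hamming h2.1 (quadWord_mem _)
    rw [codeTranslate_cell hy, zero_add] at h
    exact ⟨hy, hk.cell_injective h⟩
  · rintro ⟨hy, h⟩
    change codeTranslate y (cell e k 0) = cell e k 0
    rw [codeTranslate_cell hy, zero_add, show theta e y = 0 from h]

theorem mem_codeTranslate_fiber_zero {a x : Word} (ha : a ∈ hamming e) :
    x ∈ codeTranslate a (fiber e {0}) ↔ x ∈ hamming e ∧ theta e x = theta e a := by
  rw [codeTranslate_fiber ha]
  simp [fiber]

theorem Biv.IsClique.exists_isKerDecomposition (hk : IsClique k)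
    (h0 : (0 : Word) ∈ fiber e (Set.range k)) :
    ∃ a : Fin 7 → Word, IsKerDecomposition (fiber e (Set.range k)) a := by
  obtain ⟨-, i₀, hi₀⟩ := h0
  rw [theta_zero] at hi₀
  -- Renumber so that the zero bivector, present because the zero word is in the code, comes first.
  let k' : Fin 8 → Biv := fun i => k (Equiv.swap 0 i₀ i)
  have hk' : IsClique k' := fun i j hij => hk _ _ (by simpa using hij)
  have h0' : k' 0 = 0 := by simp [k', hi₀]
  have hr : Set.range k = Set.range k' := by
    ext x
    exact ⟨fun ⟨i, h⟩ => ⟨Equiv.swap 0 i₀ i, by simp [k', h]⟩, fun ⟨i, h⟩ => ⟨_, h⟩⟩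
  refine ⟨fun i => quadWord e (k' i.succ), ?_⟩
  rw [IsKerDecomposition, hk.codeKer_eq, hr]
  refine ⟨?_, ?_, ?_⟩
  · ext x
    simp only [Set.mem_union, Set.mem_iUnion, mem_codeTranslate_fiber_zero (quadWord_mem _),
      theta_quadWord]
    constructor
    · rintro ⟨hx, i, hi⟩
      by_cases hi0 : i = 0
      · left; exact ⟨hx, by rw [← hi, hi0, h0']; rfl⟩
      · obtain ⟨j, rfl⟩ := Fin.exists_succ_eq.mpr hi0
        exact .inr ⟨j, hx, hi.symm⟩
    · rintro (⟨hx, h⟩ | ⟨i, hx, h⟩)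
      · exact ⟨hx, 0, by rw [h0']; exact h.symm⟩
      · exact ⟨hx, i.succ, h.symm⟩
  · intro i
    rw [Set.disjoint_left]
    rintro x ⟨hx, h⟩ hx'
    rw [mem_codeTranslate_fiber_zero (quadWord_mem _), theta_quadWord] at hx'
    have : k' i.succ = k' 0 := by rw [← hx'.2, h0']; exact h
    exact Fin.succ_ne_zero i (hk'.injective this)
  · intro i j hij
    rw [Set.disjoint_left]
    intro x hx hx'
    rw [mem_codeTranslate_fiber_zero (quadWord_mem _), theta_quadWord] at hx hx'
    exact hij (Fin.succ_injective _ (hk'.injective (hx.2.symm.trans hx'.2)))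

/-- A kernel decomposition labels the clique of a code. -/
theorem Biv.IsClique.of_isKerDecomposition (hk : IsClique k)
    (h0 : (0 : Word) ∈ fiber e (Set.range k)) {a : Fin 7 → Word}
    (ha : IsKerDecomposition (fiber e (Set.range k)) a) :
    (∀ i, a i ∈ hamming e) ∧ ∃ k' : Fin 8 → Biv, IsClique k' ∧ k' 0 = 0 ∧
      (∀ i, k' i.succ = theta e (a i)) ∧ Set.range k' = Set.range k := by
  rw [IsKerDecomposition, hk.codeKer_eq] at ha
  obtain ⟨h1, h2, h3⟩ := ha
  have hz : (0 : Word) ∈ fiber e {0} := ⟨zero_mem_hamming, theta_zero⟩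
  have hself : ∀ i, a i ∈ codeTranslate (a i) (fiber e {0}) := fun i => ⟨0, hz, add_zero _⟩
  have haN : ∀ i, a i ∈ fiber e (Set.range k) := fun i => by
    rw [h1]; exact .inr (Set.mem_iUnion.mpr ⟨i, hself i⟩)
  have haH : ∀ i, a i ∈ hamming e := fun i => (haN i).1
  let k' : Fin 8 → Biv := Fin.cons 0 fun i => theta e (a i)
  have hk'0 : k' 0 = 0 := rfl
  have hk's : ∀ i, k' i.succ = theta e (a i) := fun i => rfl
  have hne : ∀ i, theta e (a i) ≠ 0 := fun i h =>
    Set.disjoint_left.mp (h2 i) ⟨haH i, h⟩ (hself i)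
  have hinj : Function.Injective k' := by
    intro i j
    refine Fin.cases ?_ (fun i => ?_) i <;> refine Fin.cases ?_ (fun j => ?_) j
    · intro _; rfl
    · intro h; exact absurd h.symm (hne j)
    · intro h; exact absurd h (hne i)
    · intro h
      by_contra hij
      have hij : i ≠ j := fun h => hij (by rw [h])
      exact Set.disjoint_left.mp (h3 i j hij) (hself i)
        ((mem_codeTranslate_fiber_zero (haH j)).mpr ⟨haH i, h⟩)
  have hmem : ∀ i, k' i ∈ Set.range k := by
    intro i
    refine Fin.cases ?_ (fun i => ?_) i
    · have := h0.2
      rwa [theta_zero] at this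
    · exact (haN i).2
  refine ⟨haH, k', ?_, hk'0, hk's, ?_⟩
  · intro i j hij
    obtain ⟨p, hp⟩ := hmem i
    obtain ⟨q, hq⟩ := hmem j
    rw [← hp, ← hq]
    exact hk p q fun h => hij (hinj (by rw [← hp, ← hq, h]))
  · apply Set.eq_of_subset_of_ncard_le
    · rintro _ ⟨i, rfl⟩; exact hmem i
    · rw [← Set.image_univ, ← Set.image_univ, Set.ncard_image_of_injective _ hinj,
        Set.ncard_image_of_injective _ hk.injective]
    · exact Set.finite_range _

theorem hamming_sum_mem {ι : Type*} (L : Finset ι) {a : ι → Word} (ha : ∀ i, a i ∈ hamming e) :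
    ∑ i ∈ L, a i ∈ hamming e := by
  classical
  induction L using Finset.induction_on with
  | empty => exact zero_mem_hamming
  | insert i L hi ih => rw [Finset.sum_insert hi]; exact add_mem_hamming (ha i) ih

theorem theta_sum {ι : Type*} (L : Finset ι) (a : ι → Word) :
    theta e (∑ i ∈ L, a i) = ∑ i ∈ L, theta e (a i) := by
  classical
  induction L using Finset.induction_on with
  | empty => exact theta_zero
  | insert i L hi ih => rw [Finset.sum_insert hi, theta_add, ih, Finset.sum_insert hi]

theorem planePartition_eq {a : Fin 7 → Word} (ha : ∀ i, a i ∈ hamming e)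
    (hk : ∀ i, k i.succ = theta e (a i)) (S : Finset (Finset (Fin 7))) :
    planePartition (cell e k 0) a S = cell e k '' planeSet k S := by
  have htr : ∀ L : Finset (Fin 7), codeTranslate (∑ i ∈ L, a i) (cell e k 0) =
      cell e k (lineSum k L) := by
    intro L
    rw [codeTranslate_cell (hamming_sum_mem L ha), zero_add, theta_sum, lineSum]
    simp only [hk]
  ext C
  simp only [planePartition, planeSet, htr, Set.mem_union, Set.mem_singleton_iff,
    Finset.coe_insert, Finset.coe_image, Set.image_insert_eq, Set.mem_insert_iff]
  refine or_congr Iff.rfl ?_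
  constructor
  · rintro ⟨L, hL, rfl⟩; exact ⟨_, ⟨L, hL, rfl⟩, rfl⟩
  · rintro ⟨_, ⟨L, hL, rfl⟩, rfl⟩; exact ⟨L, hL, rfl⟩

end Kernel

/-! ### Coordinate permutations and the invariant `HasPair` -/

section Perm

theorem permWord_permWord (π ρ : Equiv.Perm (Fin 16)) (y : Word) :
    permWord π (permWord ρ y) = permWord (ρ * π) y := rfl

theorem permCode_permCode (π ρ : Equiv.Perm (Fin 16)) (C : Set Word) :
    permCode π (permCode ρ C) = permCode (ρ * π) C := by
  simp only [permCode, Set.image_image, permWord_permWord]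

theorem permCode_one (C : Set Word) : permCode 1 C = C := by
  have : permWord 1 = id := rfl
  rw [permCode, this, Set.image_id]

theorem permWord_injective (π : Equiv.Perm (Fin 16)) : Function.Injective (permWord π) := by
  intro x y h
  funext i
  have := congrFun h (π⁻¹ i)
  simpa [permWord] using this

theorem permCode_inv {H : Set Word} {π : Equiv.Perm (Fin 16)} (h : π ∈ codeSym H) :
    π⁻¹ ∈ codeSym H := by
  have h : permCode π H = H := h
  change permCode π⁻¹ H = H
  rw [← h, permCode_permCode, mul_inv_cancel, permCode_one, h]

theorem PartitionIso.symm {H : Set Word} {P Q : Set (Set Word)} (h : PartitionIso H P Q) :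
    PartitionIso H Q P := by
  obtain ⟨π, hπ, rfl⟩ := h
  refine ⟨π⁻¹, permCode_inv hπ, ?_⟩
  simp only [Set.image_image, permCode_permCode, mul_inv_cancel, permCode_one, Set.image_id']

theorem PartitionIso.trans {H : Set Word} {P Q R : Set (Set Word)} (h : PartitionIso H P Q)
    (h' : PartitionIso H Q R) : PartitionIso H P R := by
  obtain ⟨π, hπ, rfl⟩ := h
  obtain ⟨ρ, hρ, rfl⟩ := h'
  -- `permWord` is a right action, so the permutation applied first stands on the left.
  refine ⟨π * ρ, ?_, ?_⟩
  · have hπ : permCode π H = H := hπ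
    have hρ : permCode ρ H = H := hρ
    change permCode (π * ρ) H = H
    rw [← permCode_permCode, hπ, hρ]
  · simp only [Set.image_image, permCode_permCode]

theorem PartitionIso.refl (H : Set Word) (P : Set (Set Word)) : PartitionIso H P P :=
  ⟨1, permCode_one H, by simp only [permCode_one, Set.image_id']⟩

theorem hammingDist_permWord (π : Equiv.Perm (Fin 16)) (x y : Word) :
    hammingDist (permWord π x) (permWord π y) = hammingDist x y := by
  refine Finset.card_bij (fun i _ => π i) ?_ ?_ ?_
  · intro i hi
    exact Finset.mem_filter.mpr ⟨Finset.mem_univ _, (Finset.mem_filter.mp hi).2⟩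
  · intro i _ j _ h; exact π.injective h
  · intro i hi
    refine ⟨π.symm i, Finset.mem_filter.mpr ⟨Finset.mem_univ _, ?_⟩, by simp⟩
    simpa only [permWord, Equiv.apply_symm_apply] using (Finset.mem_filter.mp hi).2

theorem IsNordstromRobinson.permCode {C : Set Word} (hC : IsNordstromRobinson C)
    (π : Equiv.Perm (Fin 16)) : IsNordstromRobinson (permCode π C) := by
  refine ⟨?_, ?_, ?_⟩
  · rw [_root_.permCode, Set.ncard_image_of_injective _ (permWord_injective π), hC.1]
  · obtain ⟨a, ha, b, hb, hab, h⟩ := hC.2.1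
    exact ⟨_, ⟨a, ha, rfl⟩, _, ⟨b, hb, rfl⟩, fun h => hab (permWord_injective π h),
      by rw [hammingDist_permWord, h]⟩
  · rintro _ ⟨_, ⟨a, ha, rfl⟩, _, ⟨b, hb, rfl⟩, hab, rfl⟩
    simp only [hammingDist_permWord]
    exact hC.2.2 ⟨a, ha, b, hb, fun h => hab (by rw [h]), rfl⟩

theorem IsNRPartition.image {H : Set Word} {P : Set (Set Word)} (hP : IsNRPartition H P)
    {π : Equiv.Perm (Fin 16)} (hπ : π ∈ codeSym H) : IsNRPartition H (permCode π '' P) := by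
  obtain ⟨h1, h2, h3⟩ := hP
  refine ⟨?_, ?_, ?_⟩
  · rintro _ ⟨C, hC, rfl⟩; exact (h1 C hC).permCode π
  · rintro _ ⟨C, hC, rfl⟩ _ ⟨D, hD, rfl⟩ hCD
    exact Set.disjoint_image_of_injective (permWord_injective π)
      (h2 hC hD fun h => hCD (by rw [h]))
  · have hπ : permCode π H = H := hπ
    rw [← hπ, ← h3]
    simp only [permCode, Set.image_sUnion, Set.sUnion_image]

theorem permWord_fourWord (π : Equiv.Perm (Fin 16)) (i j m n : Fin 16) :
    permWord π (fourWord i j m n) = fourWord (π⁻¹ i) (π⁻¹ j) (π⁻¹ m) (π⁻¹ n) := by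
  funext a
  simp only [permWord, fourWord, Pi.add_apply, Pi.single_apply, Equiv.Perm.eq_inv_iff_eq]

/-- Some pair of positions is such that every member of `P` can be translated by the words of
weight four through the pair. -/
def HasPair (H : Set Word) (P : Set (Set Word)) : Prop :=
  ∃ i j : Fin 16, i ≠ j ∧ ∀ m n, fourWord i j m n ∈ H →
    ∀ C ∈ P, codeTranslate (fourWord i j m n) C ∈ P

theorem permCode_codeTranslate (π : Equiv.Perm (Fin 16)) (y : Word) (C : Set Word) :
    permCode π (codeTranslate y C) = codeTranslate (permWord π y) (permCode π C) := by
  simp only [permCode, codeTranslate, Set.image_image]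
  rfl

theorem HasPair.of_iso {H : Set Word} {P Q : Set (Set Word)} (hP : HasPair H P)
    (h : PartitionIso H P Q) : HasPair H Q := by
  obtain ⟨π, hπ, rfl⟩ := h
  obtain ⟨i, j, hij, hp⟩ := hP
  refine ⟨π⁻¹ i, π⁻¹ j, by simpa using hij, ?_⟩
  rintro m n hmn _ ⟨C, hC, rfl⟩
  have he : fourWord (π⁻¹ i) (π⁻¹ j) m n = permWord π (fourWord i j (π m) (π n)) := by
    rw [permWord_fourWord]; simp
  rw [he] at hmn ⊢
  have hπ : permCode π H = H := hπ
  rw [← hπ] at hmn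
  obtain ⟨y, hy, hyy⟩ := hmn
  rw [permWord_injective π hyy] at hy
  exact ⟨_, hp _ _ hy C hC, permCode_codeTranslate _ _ _⟩

end Perm

/-! ### Shears as symmetries of the Hamming code; isomorphism of partitions -/

section Shear

variable {e : Fin 16 ≃ (Fin 4 → ZMod 2)} {k : Fin 8 → Biv}

theorem dot_add_right (u v w : Vec) : dot u (v + w) = dot u v + dot u w := by
  rw [dot_comm, dot_add_left, dot_comm v, dot_comm w]

theorem dot_smul_right (u : Vec) (c : ZMod 2) (v : Vec) : dot u (c • v) = c * dot u v := by
  simp [dot]; ring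

theorem shear_vec_involutive {l u : Vec} (h : dot l u = 0) (v : Vec) :
    v + dot l v • u + dot l (v + dot l v • u) • u = v := by
  rw [dot_add_right, dot_smul_right, h, mul_zero, add_zero, add_assoc, ← add_smul,
    CharTwo.add_self_eq_zero, zero_smul, add_zero]

/-- The coordinate permutation induced by the linear map `v ↦ v + (l · v) u`. -/
def shearPerm (e : Fin 16 ≃ (Fin 4 → ZMod 2)) (l u : Vec) (h : dot l u = 0) :
    Equiv.Perm (Fin 16) :=
  Function.Involutive.toPerm (fun n => e.symm (e n + dot l (e n) • u)) fun n => by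
    simp only [Equiv.apply_symm_apply, shear_vec_involutive h, Equiv.symm_apply_apply]

theorem apply_shearPerm (l u : Vec) (h : dot l u = 0) (n : Fin 16) :
    e (shearPerm e l u h n) = e n + dot l (e n) • u := by
  change e (e.symm (e n + dot l (e n) • u)) = _
  rw [Equiv.apply_symm_apply]

theorem shearPerm_mul_self (l u : Vec) (h : dot l u = 0) :
    shearPerm e l u h * shearPerm e l u h = 1 :=
  Equiv.ext fun n => Function.Involutive.toPerm_involutive _ n

theorem sum_permWord_smul {M : Type*} [AddCommMonoid M] [Module (ZMod 2) M] (l u : Vec)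
    (h : dot l u = 0) (f : Vec → M) (x : Word) :
    ∑ n, permWord (shearPerm e l u h) x n • f (e n) =
      ∑ n, x n • f (e n + dot l (e n) • u) := by
  rw [← Equiv.sum_comp (shearPerm e l u h) fun n => x n • f (e n + dot l (e n) • u)]
  refine Finset.sum_congr rfl fun n _ => ?_
  rw [apply_shearPerm, shear_vec_involutive h]
  rfl

/-- The linear part of the action of a linear map on quadratic monomials. -/
def shearCorrection (l u : Vec) : Vec →ₗ[ZMod 2] Biv where
  toFun v := ![u 0 * l 1 * v 1 + u 1 * l 0 * v 0 + dot l v * u 0 * u 1,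
    u 0 * l 2 * v 2 + u 2 * l 0 * v 0 + dot l v * u 0 * u 2,
    u 0 * l 3 * v 3 + u 3 * l 0 * v 0 + dot l v * u 0 * u 3,
    u 1 * l 2 * v 2 + u 2 * l 1 * v 1 + dot l v * u 1 * u 2,
    u 1 * l 3 * v 3 + u 3 * l 1 * v 1 + dot l v * u 1 * u 3,
    u 2 * l 3 * v 3 + u 3 * l 2 * v 2 + dot l v * u 2 * u 3]
  map_add' v w := by ext i; fin_cases i <;> simp [dot] <;> ring
  map_smul' c v := by ext i; fin_cases i <;> simp [dot] <;> ring

theorem quad_shear (l u v : Vec) :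
    quad (v + dot l v • u) = shear l u (quad v) + shearCorrection l u v := by
  have sq : ∀ a : ZMod 2, a * a = a := by decide
  have s0 := sq (v 0)
  have s1 := sq (v 1)
  have s2 := sq (v 2)
  have s3 := sq (v 3)
  have sd := sq (dot l v)
  ext i
  simp only [shear, Pi.add_apply]
  fin_cases i <;> simp [quad, act, wedge, shearCorrection, dot] at * <;> grind

theorem shear_smul (l u : Vec) (c : ZMod 2) (x : Biv) : shear l u (c • x) = c • shear l u x := by
  obtain rfl | rfl : c = 0 ∨ c = 1 := by revert c; decide
  · simp [shear_zero_right]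
  · simp

theorem shear_sum {ι : Type*} (s : Finset ι) (l u : Vec) (f : ι → Biv) :
    shear l u (∑ i ∈ s, f i) = ∑ i ∈ s, shear l u (f i) := by
  classical
  induction s using Finset.induction_on with
  | empty => exact shear_zero_right l u
  | insert i s hi ih => rw [Finset.sum_insert hi, shear_add, ih, Finset.sum_insert hi]

theorem permWord_shearPerm_mem {l u : Vec} (h : dot l u = 0) {x : Word} (hx : x ∈ hamming e) :
    permWord (shearPerm e l u h) x ∈ hamming e := by
  refine ⟨?_, ?_⟩
  · rw [← hx.1]
    exact Equiv.sum_comp (shearPerm e l u h) x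
  · rw [sum_permWord_smul l u h (fun v => v) x]
    let D : Vec →ₗ[ZMod 2] Vec :=
      { toFun := fun v => v + dot l v • u
        map_add' := fun v w => by rw [dot_add_right, add_smul]; abel
        map_smul' := fun c v => by
          rw [dot_smul_right, RingHom.id_apply, smul_add, mul_smul] }
    have : ∑ n, x n • (e n + dot l (e n) • u) = D (∑ n, x n • e n) := by
      rw [map_sum]; simp only [map_smul]; rfl
    rw [this, hx.2, map_zero]

/-- The quadratic monomials transform by the shear up to a term linear in the column, by
`quad_shear`. That term sums to zero because the columns of a Hamming word do. -/
theorem theta_permWord_shearPerm {l u : Vec} (h : dot l u = 0) {x : Word}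
    (hx : x ∈ hamming e) : theta e (permWord (shearPerm e l u h) x) = shear l u (theta e x) := by
  rw [theta, sum_permWord_smul l u h quad x]
  simp only [quad_shear, smul_add, Finset.sum_add_distrib]
  have : ∑ n, x n • shearCorrection l u (e n) = 0 := by
    simp only [← map_smul]
    rw [← map_sum, hx.2, map_zero]
  rw [this, add_zero, theta, shear_sum]
  simp only [shear_smul]

theorem permCode_shearPerm_fiber {l u : Vec} (h : dot l u = 0) (K : Set Biv) :
    permCode (shearPerm e l u h) (fiber e K) = fiber e (shear l u '' K) := by
  ext x
  constructor
  · rintro ⟨y, ⟨hy, hK⟩, rfl⟩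
    exact ⟨permWord_shearPerm_mem h hy, _, hK, (theta_permWord_shearPerm h hy).symm⟩
  · rintro ⟨hx, q, hq, hqx⟩
    refine ⟨permWord (shearPerm e l u h) x, ⟨permWord_shearPerm_mem h hx, ?_⟩, ?_⟩
    · rw [theta_permWord_shearPerm h hx, ← hqx, shear_shear l u h]; exact hq
    · rw [permWord_permWord, shearPerm_mul_self]; rfl

theorem shearPerm_mem_codeSym {l u : Vec} (h : dot l u = 0) :
    shearPerm e l u h ∈ codeSym (hamming e) := by
  have : hamming e = fiber e Set.univ := by simp [fiber]
  change permCode _ _ = _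
  rw [this, permCode_shearPerm_fiber, Set.image_univ_of_surjective]
  exact Function.RightInverse.surjective (g := shear l u) (shear_shear l u h)

theorem permCode_shearPerm_cell {l u : Vec} (h : dot l u = 0) (x : Biv) :
    permCode (shearPerm e l u h) (cell e k x) =
      cell e (fun i => shear l u (k i)) (shear l u x) := by
  have : shear l u ∘ (fun i => k i + x) = fun i => shear l u (k i) + shear l u x :=
    funext fun i => shear_add _ _ _ _
  rw [cell, permCode_shearPerm_fiber, ← Set.range_comp, this, cell]

theorem cell_congr {k' : Fin 8 → Biv} (h : Set.range k = Set.range k') (x : Biv) :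
    cell e k x = cell e k' x := by
  have : ∀ k : Fin 8 → Biv, cell e k x = fiber e ((fun z => z + x) '' Set.range k) := by
    intro k
    rw [← Set.range_comp]; rfl
  rw [this, this, h]

/-- Every partition is isomorphic to one that has a given member containing zero. -/
theorem Biv.IsClique.exists_iso_mem (hk : IsClique k) (h0 : k 0 = 0) {P : Set (Set Word)}
    (hP : IsNRPartition (hamming e) P) :
    ∃ Q, IsNRPartition (hamming e) Q ∧ cell e k 0 ∈ Q ∧ PartitionIso (hamming e) P Q := by
  have hz : (0 : Word) ∈ ⋃₀ P := by rw [hP.2.2]; exact zero_mem_hamming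
  obtain ⟨C, hC, h0C⟩ := hz
  obtain ⟨m, rfl⟩ := hk.exists_eq_cell (hP.1 C hC) (hP.subset_hamming hC)
  obtain ⟨-, j, hj⟩ := h0C
  simp only [theta_zero, add_eq_zero_iff] at hj
  subst hj
  by_cases hj0 : j = 0
  · refine ⟨P, hP, ?_, PartitionIso.refl _ _⟩
    rwa [hj0, h0] at hC
  · have hl : (fun _ => 1 : Vec) ≠ 0 := by decide
    set l : Vec := fun _ => 1
    have hd := dot_act_self (k j) l
    set π := shearPerm e l (act (k j) l) hd
    refine ⟨permCode π '' P, hP.image (shearPerm_mem_codeSym hd), ?_, π,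
      shearPerm_mem_codeSym hd, rfl⟩
    -- The shear fixing `k j` exchanges the two cells of index 0 and `k j`, so it brings the member
    -- containing zero to the prescribed cell.
    have h1 : permCode π (cell e k 0) = cell e k (k j) := by
      rw [permCode_shearPerm_cell, shear_zero_right, cell_zero, hk.range_shear h0 hj0 hl, cell]
    refine ⟨_, hC, ?_⟩
    rw [← h1, permCode_permCode, shearPerm_mul_self, permCode_one]

theorem Biv.IsClique.coe_planeSet_annih (hk : IsClique k) (h0 : k 0 = 0) {b : Bool} {v : Vec}
    (hv : v ≠ 0) : (planeSet k (triplesIn k (annih b v)) : Set Biv) = annih b v := by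
  ext x
  exact hk.mem_planeSet_triplesIn h0 (zero_mem_annih b v) fun x hx => pf_of_mem_annih hv hx

/-- Fano planes of the same type give isomorphic partitions. -/
theorem Biv.IsClique.iso_of_hasType (hk : IsClique k) (h0 : k 0 = 0) {b : Bool}
    {S T : Finset (Finset (Fin 7))} (hS : HasType k b S) (hT : HasType k b T) :
    PartitionIso (hamming e) (cell e k '' planeSet k S) (cell e k '' planeSet k T) := by
  obtain ⟨v, hv, rfl⟩ := hS
  obtain ⟨w, hw, rfl⟩ := hT
  rw [hk.coe_planeSet_annih h0 hv, hk.coe_planeSet_annih h0 hw]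
  obtain ⟨l₁, u₁, l₂, u₂, h₁, h₂, hr, ha⟩ := hk.exists_shear_shear h0 b hv hw
  refine PartitionIso.trans ⟨_, shearPerm_mem_codeSym h₁, rfl⟩
    ⟨_, shearPerm_mem_codeSym h₂, ?_⟩
  rw [← ha]
  simp only [Set.image_image, permCode_shearPerm_cell]
  refine Set.image_congr fun x _ => ?_
  exact cell_congr hr _

/-- The type of a Fano plane is visible in the partition. -/
theorem Biv.IsClique.hasPair_iff (hk : IsClique k) (h0 : k 0 = 0)
    {S : Finset (Finset (Fin 7))} (hS : IsFanoPlane S) :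
    HasPair (hamming e) (cell e k '' planeSet k S) ↔ HasType k true S := by
  constructor
  · rintro ⟨i, j, hij, hp⟩
    have hw : e i + e j ≠ 0 := fun h => hij (e.injective (vec_add_eq_zero.mp h))
    refine ⟨e i + e j, hw, ?_⟩
    symm
    -- Translating the cell of index zero by words of weight four through i and j reaches every
    -- index in the annihilator of e i + e j, so the plane contains, and hence equals, the plane of
    -- that annihilator.
    refine (hk.triplesIn_annih_isFanoPlane h0 true hw).eq_of_subset hS fun L hL => ?_
    obtain ⟨hL3, hL⟩ := mem_triplesIn.mp hL
    obtain ⟨m, n, hm, ht⟩ := exists_fourWord hw hL i j rfl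
    have hz : (0 : Biv) ∈ (planeSet k S : Set Biv) := by simp [planeSet]
    have hc := hp m n hm (cell e k 0) (Set.mem_image_of_mem _ hz)
    rw [codeTranslate_cell hm, zero_add, ht, hk.cell_injective.mem_set_image] at hc
    rwa [← hk.lineSum_mem_planeSet_iff h0 hS hL3]
  · rintro ⟨w, hw, rfl⟩
    -- The columns of this pair differ by w, so the weight-four words through it have bivectors in
    -- the annihilator of w, which is closed under addition.
    refine ⟨e.symm 0, e.symm w, fun h => hw (e.symm.injective h).symm, ?_⟩
    rw [hk.coe_planeSet_annih h0 hw]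
    rintro m n hm _ ⟨x, hx, rfl⟩
    rw [codeTranslate_cell hm]
    apply Set.mem_image_of_mem
    change actOf true _ w = 0
    rw [actOf_add, show actOf true x w = 0 from hx, theta_fourWord hm,
      Equiv.apply_symm_apply, Equiv.apply_symm_apply, zero_add, zero_add]
    exact act_star_wedge w _

/-- Two Fano planes give isomorphic partitions if and only if they lie in the same orbit. -/
theorem Biv.IsClique.iso_iff (hk : IsClique k) (h0 : k 0 = 0)
    {S T : Finset (Finset (Fin 7))} (hS : IsFanoPlane S) (hT : IsFanoPlane T) :
    PartitionIso (hamming e) (cell e k '' planeSet k S) (cell e k '' planeSet k T) ↔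
      T ∈ a7Orbit S := by
  obtain ⟨b, hb⟩ := hk.exists_hasType h0 hS
  rw [hk.mem_a7Orbit_iff h0 hS hb]
  constructor
  · intro h
    obtain ⟨c, hc⟩ := hk.exists_hasType h0 hT
    have hiff : HasType k true S ↔ HasType k true T := by
      rw [← hk.hasPair_iff (e := e) h0 hS, ← hk.hasPair_iff (e := e) h0 hT]
      exact ⟨fun h' => h'.of_iso h, fun h' => h'.of_iso h.symm⟩
    cases b <;> cases c
    · exact hc
    · have h1 := hk.not_hasType_not h0 hb
      rw [Bool.not_false] at h1
      exact absurd (hiff.mpr hc) h1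
    · exact hiff.mp hb
    · exact hc
  · intro h
    exact hk.iso_of_hasType h0 hb h

end Shear

/-! ### A Nordstrom–Robinson code inside the Hamming code -/

section Existence

variable {e : Fin 16 ≃ (Fin 4 → ZMod 2)}

/-- A clique of eight bivectors. -/
def stdClique : Fin 8 → Biv :=
  ![0, ![1, 0, 0, 0, 0, 1], ![0, 0, 1, 1, 0, 1], ![0, 1, 0, 1, 1, 1], ![0, 1, 1, 0, 1, 1],
    ![1, 0, 1, 1, 1, 0], ![1, 1, 0, 0, 1, 0], ![1, 1, 1, 1, 0, 0]]

theorem stdClique_isClique : IsClique stdClique := by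
  unfold IsClique
  decide +kernel

theorem card_support_cast (x : Word) :
    ((Finset.univ.filter fun i => x i ≠ 0).card : ZMod 2) = ∑ i, x i := by
  rw [Finset.card_filter, Nat.cast_sum]
  refine Finset.sum_congr rfl fun i _ => ?_
  exact (by decide : ∀ a : ZMod 2, ((if a ≠ 0 then 1 else 0 : ℕ) : ZMod 2) = a) _

theorem eq_sum_single (x : Word) :
    x = ∑ i ∈ Finset.univ.filter fun i => x i ≠ 0, (Pi.single i 1 : Word) := by
  funext j
  rw [Finset.sum_apply]
  simp only [Pi.single_apply, Finset.sum_ite_eq, Finset.mem_filter, Finset.mem_univ, true_and]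
  exact (by decide : ∀ a : ZMod 2, a = if a ≠ 0 then 1 else 0) _

/-- Words of the Hamming code with zero or nonsingular bivector have weight at least six. -/
theorem six_le_card_support {x : Word} (hx : x ∈ hamming e) (hx0 : x ≠ 0)
    (h : theta e x = 0 ∨ pf (theta e x) = 1) :
    6 ≤ (Finset.univ.filter fun i => x i ≠ 0).card := by
  have hcast := card_support_cast x
  have hsum := eq_sum_single x
  set s := Finset.univ.filter fun i => x i ≠ 0
  rw [hx.1, ZMod.natCast_eq_zero_iff] at hcast
  by_contra hlt
  have : s.card = 0 ∨ s.card = 2 ∨ s.card = 4 := by omega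
  rcases this with h0 | h2 | h4
  · rw [Finset.card_eq_zero.mp h0, Finset.sum_empty] at hsum
    exact hx0 hsum
  · obtain ⟨a, b, hab, hs⟩ := Finset.card_eq_two.mp h2
    rw [hs, Finset.sum_pair hab] at hsum
    have := hx.2
    rw [hsum] at this
    simp only [Pi.add_apply, add_smul, Finset.sum_add_distrib, Pi.single_apply, ite_smul,
      one_smul, zero_smul, Finset.sum_ite_eq', Finset.mem_univ, if_true] at this
    exact hab (e.injective (vec_add_eq_zero.mp this))
  · obtain ⟨a, t, hat, hs, ht3⟩ := Finset.card_eq_succ.mp h4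
    obtain ⟨b, c, d, hbc, hbd, hcd, rfl⟩ := Finset.card_eq_three.mp ht3
    simp only [Finset.mem_insert, Finset.mem_singleton, not_or] at hat
    have hfour : x = fourWord a b c d := by
      rw [hsum, ← hs, Finset.sum_insert (by simp [hat]), Finset.sum_insert (by simp [hbc, hbd]),
        Finset.sum_pair hcd, fourWord]
      simp only [add_assoc]
    rw [hfour] at hx h
    rw [theta_fourWord hx, pf_wedge] at h
    have h := h.resolve_right zero_ne_one
    have hab : e a + e b ≠ 0 := fun h => hat.1 (e.injective (vec_add_eq_zero.mp h))
    rcases wedge_eq_zero _ hab _ h with h | h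
    · exact hat.2.1 (e.injective (vec_add_eq_zero.mp h))
    · exact hbc (e.injective (add_left_cancel h)).symm

/-- The form v0v1 + v2v3 belongs to the member `stdClique 1`; its weight shows that distance six is
attained. -/
theorem weight_quadForm :
    (Finset.univ.filter fun v => quadForm ![1, 0, 0, 0, 0, 1] v ≠ 0).card = 6 := by
  decide +kernel

/-- The Hamming code contains a Nordstrom–Robinson code. -/
theorem isNordstromRobinson_stdClique : IsNordstromRobinson (cell e stdClique 0) := by
  have hk := stdClique_isClique
  refine ⟨?_, ⟨?_, ?_⟩⟩
  · rw [cell_zero, ncard_fiber, ← Set.image_univ, Set.ncard_image_of_injective _ hk.injective]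
    simp [Set.ncard_univ]
  · refine ⟨0, ⟨zero_mem_hamming, 0, ?_⟩, quadWord e ![1, 0, 0, 0, 0, 1],
      ⟨quadWord_mem _, 1, ?_⟩, ?_, ?_⟩
    · rw [theta_zero]; exact add_zero _
    · rw [theta_quadWord]; exact add_zero _
    · intro h
      have := theta_quadWord (e := e) ![1, 0, 0, 0, 0, 1]
      rw [← h, theta_zero] at this
      exact absurd this (by decide)
    · rw [← weight_quadForm]
      refine Finset.card_bij (fun i _ => e i) ?_ ?_ ?_
      · intro i hi
        exact Finset.mem_filter.mpr ⟨Finset.mem_univ _, (Finset.mem_filter.mp hi).2.symm⟩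
      · intro i _ j _ h; exact e.injective h
      · intro v hv
        refine ⟨e.symm v, Finset.mem_filter.mpr ⟨Finset.mem_univ _, ?_⟩, by simp⟩
        have := (Finset.mem_filter.mp hv).2
        change (0 : ZMod 2) ≠ quadForm _ (e (e.symm v))
        rw [Equiv.apply_symm_apply]
        exact this.symm
  · rintro _ ⟨x, ⟨hx, i, hi⟩, y, ⟨hy, j, hj⟩, hxy, rfl⟩
    have key := six_le_card_support (add_mem_hamming hx hy)
      (fun h => hxy (word_add_eq_zero.mp h)) ?_
    · refine key.trans (Finset.card_le_card fun a ha => ?_)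
      refine Finset.mem_filter.mpr ⟨Finset.mem_univ _, fun h => (Finset.mem_filter.mp ha).2 ?_⟩
      rw [Pi.add_apply, h, CharTwo.add_self_eq_zero]
    · simp only [add_zero] at hi hj
      rw [theta_add, ← hi, ← hj]
      by_cases hij : i = j
      · left; rw [hij, add_self]
      · right; exact hk i j hij

end Existence

/-! ### Assembly of the theorem -/

theorem mainTheorem2 (H : Set Word) (hH : IsExtendedHamming H) :
    -- there are exactly two partitions up to isomorphism
    (∃ P Q : Set (Set Word), IsNRPartition H P ∧ IsNRPartition H Q ∧ ¬ PartitionIso H P Q ∧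
      ∀ R, IsNRPartition H R → PartitionIso H R P ∨ PartitionIso H R Q) ∧
    -- the Fano planes on seven points form exactly two orbits of `A_7`, of 15 planes each
    (∃ S T : Finset (Finset (Fin 7)), IsFanoPlane S ∧ IsFanoPlane T ∧
      Disjoint (a7Orbit S) (a7Orbit T) ∧ {F | IsFanoPlane F} = a7Orbit S ∪ a7Orbit T ∧
      (a7Orbit S).ncard = 15 ∧ (a7Orbit T).ncard = 15) ∧
    -- isomorphism classes of partitions correspond to orbits of `A_7` on Fano planes
    (∀ N : Set Word, IsNordstromRobinson N → 0 ∈ N → N ⊆ H →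
      (∃ a : Fin 7 → Word, IsKerDecomposition N a) ∧
      ∀ a : Fin 7 → Word, IsKerDecomposition N a →
        Set.BijOn (planePartition N a) {S | IsFanoPlane S} {P | IsNRPartition H P ∧ N ∈ P} ∧
        (∀ S T, IsFanoPlane S → IsFanoPlane T →
          (PartitionIso H (planePartition N a S) (planePartition N a T) ↔ T ∈ a7Orbit S)) ∧
        ∀ P, IsNRPartition H P →
          ∃ S, IsFanoPlane S ∧ PartitionIso H P (planePartition N a S)) := by
  obtain ⟨e, he⟩ := hH
  obtain rfl : H = hamming e := he
  have hexists : ∀ {k : Fin 8 → Biv}, IsClique k → k 0 = 0 →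
      IsNordstromRobinson (cell e k 0) → ∀ P, IsNRPartition (hamming e) P →
      ∃ S, IsFanoPlane S ∧ PartitionIso (hamming e) P (cell e k '' planeSet k S) := by
    intro k hk h0 hN P hP
    obtain ⟨Q, hQ, hmem, hiso⟩ := hk.exists_iso_mem h0 hP
    obtain ⟨S, hS, rfl⟩ := (hk.bijOn h0 hN).surjOn ⟨hQ, hmem⟩
    exact ⟨S, hS, hiso⟩
  have hk := stdClique_isClique
  have h0 : stdClique 0 = 0 := rfl
  have hN : IsNordstromRobinson (cell e stdClique 0) := isNordstromRobinson_stdClique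
  have hfano := hk.fano_orbits h0
  refine ⟨?_, hfano, ?_⟩
  · obtain ⟨S, T, hS, hT, hdisj, hunion, -, -⟩ := hfano
    refine ⟨cell e stdClique '' planeSet stdClique S, cell e stdClique '' planeSet stdClique T,
      hk.isNRPartition h0 hN hS, hk.isNRPartition h0 hN hT, ?_, ?_⟩
    · rw [hk.iso_iff h0 hS hT]
      exact fun h => Set.disjoint_left.mp hdisj h (MulAction.mem_orbit_self T)
    · intro R hR
      obtain ⟨F, hF, hiso⟩ := hexists hk h0 hN R hR
      have : F ∈ a7Orbit S ∪ a7Orbit T := by rw [← hunion]; exact hF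
      rcases this with h | h
      · exact .inl (hiso.trans ((hk.iso_iff h0 hS hF).mpr h).symm)
      · exact .inr (hiso.trans ((hk.iso_iff h0 hT hF).mpr h).symm)
  · intro N hN h0N hNH
    obtain ⟨k₁, hk₁, rfl⟩ := hN.exists_clique hNH
    refine ⟨hk₁.exists_isKerDecomposition h0N, fun a ha => ?_⟩
    -- The given words a_i label the clique of N, so their sums over lines become the indices
    -- `lineSum k L` and the results on cells apply.
    obtain ⟨haH, k, hk, h0, hka, hr⟩ := hk₁.of_isKerDecomposition h0N ha
    have hcell : fiber e (Set.range k₁) = cell e k 0 := by rw [cell_zero, hr]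
    rw [hcell] at hN ⊢
    have hpp : planePartition (cell e k 0) a = fun S => cell e k '' planeSet k S :=
      funext fun S => planePartition_eq haH hka S
    rw [hpp]
    exact ⟨hk.bijOn h0 hN, fun S T hS hT => hk.iso_iff h0 hS hT, hexists hk h0 hN⟩
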